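/- **Setting.** Let $(y_i,x_i,\mathbf z_i)_{i\ge 1}$, with $y_i,x_i\in\mathbb R$ and $\mathbf z_i\in\mathbb R^{p_z}$, follow the categorical random coefficient model $$y_i=x_i\beta_i+\mathbf z_i'\boldsymbol\gamma+u_i,$$ where $\boldsymbol\gamma\in\mathbb R^{p_z}$ is fixed; the $\beta_i$ are i.i.d. with $\Pr(\beta_i=b_k)=\pi_k$, $k=1,\dots,K$, $b_1<\dots<b_K$, $\pi_k\in(0,1)$, $\sum_{k=1}^K\pi_k=1$; the $u_i$ are independent with $\mathrm E(u_i)=0$; and $\beta_i$ is independent of $\mathbf w_i=(x_i,\mathbf z_i')'$ for each $i$. Put $\boldsymbol\phi=(\mathrm E(\beta_i),\boldsymbol\gamma')'$, $\xi_i=u_i+x_i(\beta_i-\mathrm E(\beta_i))$, $\mathbf Q_{n,ww}=n^{-1}\sum_{i=1}^n\mathbf w_i\mathbf w_i'$, $\mathbf q_{n,wy}=n^{-1}\sum_{i=1}^n\mathbf w_iy_i$, $\hat{\boldsymbol\phi}=\mathbf Q_{n,ww}^{-1}\mathbf q_{n,wy}$. Norms of matrices are spectral norms, and $\mathbf A\succ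 0$ means that $\mathbf A$ is symmetric positive definite. **Assumption 1.** (a) (i) For each $i$, $u_i$ is independent of $(\mathbf w_i,\beta_i)$; (ii) $\sup_i\mathrm E|u_i|^r<\infty$ for $r=1,\dots,2K-1$; (iii) $n^{-1}\sum_{i=1}^nu_i^4=O_p(1)$. (b) (i) $\|\mathrm E(\mathbf Q_{n,ww})\|$ and $\|\mathrm E(\mathbf q_{n,wy})\|$ are bounded in $n$, and there are constants $0<c<C<\infty$ such that, with probability tending to one as $n\to\infty$, $c<\lambda_{\min}(\mathbf Q_{n,ww})\le\lambda_{\max}(\mathbf Q_{n,ww})<C$; (ii) $\sup_i\mathrm E\|\mathbf w_i\|^r<\infty$ for $r=1,\dots,4K-2$; (iii) $n^{-1}\sum_{i=1}^n\|\mathbf w_i\|^4=O_p(1)$. (c) $\|\mathbf Q_{n,ww}-\mathrm E(\mathbf Q_{n,ww})\|=O_p(n^{-1/2})$, $\|\mathbf q_{n,wy}-\mathrm E(\mathbf q_{n,wy})\|=O_p(n^{-1/2})$, and $\mathrm E(\mathbf Q_{n,ww})\succ0$ for all large $n$. (d) $\|\mathrm E(\mathbf Q_{n,ww})-\mathbf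 Q_{ww}\|=O(n^{-1/2})$ and $\|\mathrm E(\mathbf q_{n,wy})-\mathbf q_{wy}\|=O(n^{-1/2})$ for some $\mathbf Q_{ww}\succ0$ and some $\mathbf q_{wy}$. **Assumption 3.** $\|n^{-1}\sum_{i=1}^n\mathrm E(\mathbf w_i\mathbf w_i'\xi_i^2)-\mathbf V_{w\xi}\|=O(n^{-1/2})$ with $\mathbf V_{w\xi}\succ0$, and $\|n^{-1}\sum_{i=1}^n\mathbf w_i\mathbf w_i'\xi_i^2-n^{-1}\sum_{i=1}^n\mathrm E(\mathbf w_i\mathbf w_i'\xi_i^2)\|=O_p(n^{-1/2})$. **Theorem 3.** 1. Under Assumption 1, $\hat{\boldsymbol\phi}\to_p\boldsymbol\phi$ as $n\to\infty$, and moreover $\|\hat{\boldsymbol\phi}-\boldsymbol\phi\|=O_p(n^{-1/2})$. 2. Under Assumptions 1 and 3, if in addition the sequences $(\mathbf w_i)_{i\ge1}$, $(\beta_i)_{i\ge1}$, $(u_i)_{i\ge1}$ are mutually independent (as is the case when the $(\mathbf w_i,\beta_i,u_i)$ are independent across $i$), then $$\sqrt n(\hat{\boldsymbol\phi}-\boldsymbol\phi)\to_dN(\mathbf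 0,\mathbf V_\phi),\qquad \mathbf V_\phi=\mathbf Q_{ww}^{-1}\mathbf V_{w\xi}\mathbf Q_{ww}^{-1}.$$ 3. Under Assumptions 1 and 3, $\hat{\mathbf V}_\phi=\mathbf Q_{n,ww}^{-1}\hat{\mathbf V}_{w\xi}\mathbf Q_{n,ww}^{-1}\to_p\mathbf V_\phi$, where $\hat{\mathbf V}_{w\xi}=n^{-1}\sum_{i=1}^n\mathbf w_i\mathbf w_i'\hat\xi_i^2$ and $\hat\xi_i=y_i-\mathbf w_i'\hat{\boldsymbol\phi}$. -/

import Mathlib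

open MeasureTheory ProbabilityTheory Filter Topology Asymptotics
open scoped Matrix Matrix.Norms.L2Operator

/-- `X n = O_p(a n)`: for every `ε > 0` there are `M` and `N` with `P(|X n| > M * a n) ≤ ε` for all
`n ≥ N`. -/
def IsBigOInProb {Ω : Type*} [MeasurableSpace Ω] (P : Measure Ω)
    (X : ℕ → Ω → ℝ) (a : ℕ → ℝ) : Prop :=
  ∀ ε : ℝ, 0 < ε → ∃ M : ℝ, ∀ᶠ n : ℕ in atTop,
    P {ω | M * a n < |X n ω|} ≤ ENNReal.ofReal ε

/-- The rate `n^{-1/2}`. -/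
noncomputable def rootRate (n : ℕ) : ℝ := (Real.sqrt n)⁻¹

/-- The regressors `x i`, `z i`, the random coefficients `β i`, the errors `u i` (for every
individual `i`) and the homogeneous coefficient vector `γ`. Individuals are indexed from `0`, so
the first `n` of them are those in `Finset.range n`. -/
structure RCData (Ω : Type*) (p : ℕ) where
  x : ℕ → Ω → ℝ
  z : ℕ → Ω → EuclideanSpace ℝ (Fin p)
  β : ℕ → Ω → ℝ
  u : ℕ → Ω → ℝ
  γ : EuclideanSpace ℝ (Fin p)

namespace RCData

variable {Ω : Type*} {p : ℕ}

/-- `y_i = x_i β_i + z_i' γ + u_i`. -/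
noncomputable def y (D : RCData Ω p) (i : ℕ) (ω : Ω) : ℝ :=
  D.x i ω * D.β i ω + (D.z i ω ⬝ᵥ D.γ) + D.u i ω

/-- `w_i = (x_i, z_i')'`. -/
noncomputable def w (D : RCData Ω p) (i : ℕ) (ω : Ω) : EuclideanSpace ℝ (Fin (p + 1)) :=
  WithLp.toLp 2 (Fin.cons (D.x i ω) (D.z i ω))

/-- `Q_{n,ww} = n⁻¹ ∑ w_i w_i'`. -/
noncomputable def Qn (D : RCData Ω p) (n : ℕ) (ω : Ω) : Matrix (Fin (p + 1)) (Fin (p + 1)) ℝ :=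
  (n : ℝ)⁻¹ • ∑ i ∈ Finset.range n, Matrix.vecMulVec (D.w i ω) (D.w i ω)

/-- `q_{n,wy} = n⁻¹ ∑ w_i y_i`. -/
noncomputable def qn (D : RCData Ω p) (n : ℕ) (ω : Ω) : EuclideanSpace ℝ (Fin (p + 1)) :=
  (n : ℝ)⁻¹ • ∑ i ∈ Finset.range n, D.y i ω • D.w i ω

/-- The OLS estimator `φ̂ = Q_{n,ww}⁻¹ q_{n,wy}`. -/
noncomputable def phiHat (D : RCData Ω p) (n : ℕ) (ω : Ω) : EuclideanSpace ℝ (Fin (p + 1)) :=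
  WithLp.toLp 2 ((D.Qn n ω)⁻¹ *ᵥ (D.qn n ω))

/-- The OLS residual `ξ̂_i = y_i - w_i' φ̂` in the sample of size `n`. -/
noncomputable def xiHat (D : RCData Ω p) (n i : ℕ) (ω : Ω) : ℝ :=
  D.y i ω - (D.w i ω ⬝ᵥ D.phiHat n ω)

/-- `V̂_{wξ} = n⁻¹ ∑ w_i w_i' ξ̂_i²`. -/
noncomputable def VwHat (D : RCData Ω p) (n : ℕ) (ω : Ω) : Matrix (Fin (p + 1)) (Fin (p + 1)) ℝ :=
  (n : ℝ)⁻¹ • ∑ i ∈ Finset.range n,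
    (D.xiHat n i ω ^ 2) • Matrix.vecMulVec (D.w i ω) (D.w i ω)

/-- The sandwich estimator `V̂_φ = Q_{n,ww}⁻¹ V̂_{wξ} Q_{n,ww}⁻¹`. -/
noncomputable def VphiHat (D : RCData Ω p) (n : ℕ) (ω : Ω) :
    Matrix (Fin (p + 1)) (Fin (p + 1)) ℝ :=
  (D.Qn n ω)⁻¹ * D.VwHat n ω * (D.Qn n ω)⁻¹

variable [MeasurableSpace Ω]

/-- `φ = (E(β_i), γ')'`; the `β_i` are identically distributed, so `i = 0` stands for any `i`. -/
noncomputable def phi (D : RCData Ω p) (P : Measure Ω) : EuclideanSpace ℝ (Fin (p + 1)) :=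
  WithLp.toLp 2 (Fin.cons (∫ ω, D.β 0 ω ∂P) D.γ)

/-- `ξ_i = u_i + x_i v_i` with `v_i = β_i - E(β_i)`. -/
noncomputable def xi (D : RCData Ω p) (P : Measure Ω) (i : ℕ) (ω : Ω) : ℝ :=
  D.u i ω + D.x i ω * (D.β i ω - ∫ ω', D.β i ω' ∂P)

/-- `E(Q_{n,ww})`, entry by entry. -/
noncomputable def EQn (D : RCData Ω p) (P : Measure Ω) (n : ℕ) :
    Matrix (Fin (p + 1)) (Fin (p + 1)) ℝ :=
  Matrix.of fun a b => ∫ ω, D.Qn n ω a b ∂P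

/-- `E(q_{n,wy})`, entry by entry. -/
noncomputable def Eqn (D : RCData Ω p) (P : Measure Ω) (n : ℕ) :
    EuclideanSpace ℝ (Fin (p + 1)) :=
  WithLp.toLp 2 fun a => ∫ ω, D.qn n ω a ∂P

/-- `n⁻¹ ∑ w_i w_i' ξ_i²`. -/
noncomputable def Vn (D : RCData Ω p) (P : Measure Ω) (n : ℕ) (ω : Ω) :
    Matrix (Fin (p + 1)) (Fin (p + 1)) ℝ :=
  (n : ℝ)⁻¹ • ∑ i ∈ Finset.range n,
    (D.xi P i ω ^ 2) • Matrix.vecMulVec (D.w i ω) (D.w i ω)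

/-- `n⁻¹ ∑ E(w_i w_i' ξ_i²)`, entry by entry. -/
noncomputable def EVn (D : RCData Ω p) (P : Measure Ω) (n : ℕ) :
    Matrix (Fin (p + 1)) (Fin (p + 1)) ℝ :=
  (n : ℝ)⁻¹ • ∑ i ∈ Finset.range n,
    Matrix.of fun a b => ∫ ω, D.xi P i ω ^ 2 * (D.w i ω a * D.w i ω b) ∂P

/-- The categorical random coefficient model with support points `b` and weights `π`. -/
structure IsCategoricalModel (D : RCData Ω p) (P : Measure Ω) {K : ℕ}
    (b π : Fin K → ℝ) : Prop where
  measurable_x : ∀ i, Measurable (D.x i)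
  measurable_z : ∀ i, Measurable (D.z i)
  measurable_β : ∀ i, Measurable (D.β i)
  measurable_u : ∀ i, Measurable (D.u i)
  strictMono_b : StrictMono b
  weight_mem : ∀ k, π k ∈ Set.Ioo (0 : ℝ) 1
  weight_sum : ∑ k, π k = 1
  β_dist : ∀ i k, P {ω | D.β i ω = b k} = ENNReal.ofReal (π k)
  β_iIndep : iIndepFun D.β P
  β_indep_w : ∀ i, IndepFun (D.β i) (D.w i) P
  u_iIndep : iIndepFun D.u P
  u_mean : ∀ i, ∫ ω, D.u i ω ∂P = 0

/-- The regularity conditions (a)-(d) on errors and regressors, for `K` categories and limits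
`Qww`, `qwy`. Norms of matrices are spectral norms. -/
structure Regular (D : RCData Ω p) (P : Measure Ω) (K : ℕ)
    (Qww : Matrix (Fin (p + 1)) (Fin (p + 1)) ℝ) (qwy : EuclideanSpace ℝ (Fin (p + 1))) :
    Prop where
  /-- (a)(i) -/
  u_indep : ∀ i, IndepFun (D.u i) (fun ω => (D.w i ω, D.β i ω)) P
  /-- (a)(ii) -/
  u_moments : ∃ C : ℝ, ∀ i, ∀ r ∈ Finset.Icc 1 (2 * K - 1),
    Integrable (fun ω => |D.u i ω| ^ r) P ∧ ∫ ω, |D.u i ω| ^ r ∂P ≤ C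
  /-- (a)(iii) -/
  u_fourth : IsBigOInProb P (fun n ω => (n : ℝ)⁻¹ * ∑ i ∈ Finset.range n, D.u i ω ^ 4) (fun _ => 1)
  /-- (b)(i), the expectations -/
  EQn_bounded : ∃ C : ℝ, ∀ n, ‖D.EQn P n‖ ≤ C
  Eqn_bounded : ∃ C : ℝ, ∀ n, ‖D.Eqn P n‖ ≤ C
  /-- (b)(i), the eigenvalues: with probability tending to one, `c < λ_min(Q_{n,ww})` and
  `λ_max(Q_{n,ww}) < C` for fixed `0 < c` and `C` -/
  eigenvalues : ∃ c C : ℝ, 0 < c ∧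
    Tendsto (fun n => P {ω | ¬ spectrum ℝ (D.Qn n ω) ⊆ Set.Ioo c C}) atTop (𝓝 0)
  /-- (b)(ii) -/
  w_moments : ∃ C : ℝ, ∀ i, ∀ r ∈ Finset.Icc 1 (4 * K - 2),
    Integrable (fun ω => ‖D.w i ω‖ ^ r) P ∧ ∫ ω, ‖D.w i ω‖ ^ r ∂P ≤ C
  /-- (b)(iii) -/
  w_fourth : IsBigOInProb P (fun n ω => (n : ℝ)⁻¹ * ∑ i ∈ Finset.range n, ‖D.w i ω‖ ^ 4)
    (fun _ => 1)
  /-- (c) -/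
  Qn_rate : IsBigOInProb P (fun n ω => ‖D.Qn n ω - D.EQn P n‖) rootRate
  qn_rate : IsBigOInProb P (fun n ω => ‖D.qn n ω - D.Eqn P n‖) rootRate
  EQn_posDef : ∀ᶠ n in atTop, (D.EQn P n).PosDef
  /-- (d); the two rates make `Qww` and `qwy` the limits of `E(Q_{n,ww})` and `E(q_{n,wy})` -/
  EQn_rate : (fun n => ‖D.EQn P n - Qww‖) =O[atTop] rootRate
  Eqn_rate : (fun n => ‖D.Eqn P n - qwy‖) =O[atTop] rootRate
  Qww_posDef : Qww.PosDef

/-- The conditions on the second moments of `w_i ξ_i`, with limit `Vwξ`. -/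
structure ScoreRegular (D : RCData Ω p) (P : Measure Ω)
    (Vwξ : Matrix (Fin (p + 1)) (Fin (p + 1)) ℝ) : Prop where
  EVn_rate : (fun n => ‖D.EVn P n - Vwξ‖) =O[atTop] rootRate
  Vwξ_posDef : Vwξ.PosDef
  Vn_rate : IsBigOInProb P (fun n ω => ‖D.Vn P n ω - D.EVn P n‖) rootRate

/-- The three sequences `(w_i)`, `(β_i)` and `(u_i)` are mutually independent. This holds in
particular if the `(w_i, β_i, u_i)` are independent across `i`, `β_i ⊥ w_i` and
`u_i ⊥ (w_i, β_i)`; dependence among the `w_i` is allowed. -/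
structure IndepSequences (D : RCData Ω p) (P : Measure Ω) : Prop where
  w_indep : IndepFun (fun ω i => D.w i ω) (fun ω i => (D.β i ω, D.u i ω)) P
  β_indep_u : IndepFun (fun ω i => D.β i ω) (fun ω i => D.u i ω) P

end RCData

/-! The model can be rewritten as `y_i = w_i'φ + ξ_i`, so wherever `Q_n` is invertible `φ̂ - φ =
Q_n⁻¹ s_n`, with score `s_n = n⁻¹ ∑ w_i ξ_i`. All three claims are read off this identity.

Rate. Since `u_i` and `β_i` are each independent of `w_i`, every `w_i ξ_i` has mean zero and `E q_n
= E(Q_n) φ`. Hence `s_n = (q_n - E q_n) - (Q_n - E Q_n) φ` (`score_eq`), and the assumed rates give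
`s_n = O_p(n^{-1/2})` without any dependence condition across `i`. As `Q_n` tends in probability to
a positive definite limit, `Q_n⁻¹` is bounded with probability tending to one (`phiHat_rate`).

Normality. With the whole sequence `(w_i)` frozen, the summands `w_i ξ_i` are independent and
centred. A Lindeberg-type replacement (`norm_integral_exp_sum_sub_le`) compares `E exp(i √n t's_n)`
with `E exp(-t'V_n t / 2)`, up to `O(n^{-1/2})` by uniform third moments. Keeping the realized
squares, rather than conditional variances, makes exactly `V_n = n⁻¹ ∑ w_i w_i' ξ_i²` appear; its
convergence in probability is assumed, so bounded convergence identifies the limit. Lévy continuity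
and Slutsky finish the argument, and dependence among the `w_i` is harmless.

Sandwich. Replacing `ξ_i` by residuals in `V_n` costs a factor vanishing with `φ̂ - φ` times fourth
sample moments, which are `O_p(1)` (`norm_VwHat_sub_Vn_le`). Continuous mapping does the rest. -/

section StochasticOrder

/-! ### Calculus of `O_p` and of convergence in probability to a constant. -/

variable {Ω : Type*} [MeasurableSpace Ω] {P : Measure Ω} {X Y : ℕ → Ω → ℝ} {a : ℕ → ℝ}

lemma IsBigOInProb.exists_nonneg (h : IsBigOInProb P X a) (ha : ∀ n, 0 ≤ a n) {ε : ℝ}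
    (hε : 0 < ε) : ∃ M : ℝ, 0 ≤ M ∧ ∀ᶠ n : ℕ in atTop,
      P {ω | M * a n < |X n ω|} ≤ ENNReal.ofReal ε := by
  obtain ⟨M, hM⟩ := h ε hε
  refine ⟨max M 0, le_max_right _ _, hM.mono fun n hn => (measure_mono fun ω hω => ?_).trans hn⟩
  exact lt_of_le_of_lt (mul_le_mul_of_nonneg_right (le_max_left _ _) (ha n)) hω

/-- The exceptional event absorbs half of `ε`, so domination is needed only with probability tending
to one. This is what permits arguing on the event that `Q_n` is invertible. -/
lemma IsBigOInProb.mono_of_tendsto {C : ℝ} (h : IsBigOInProb P X a) (ha : ∀ n, 0 ≤ a n)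
    (hC : 0 ≤ C)
    (hle : Tendsto (fun n => P {ω | ¬ |Y n ω| ≤ C * |X n ω|}) atTop (𝓝 0)) :
    IsBigOInProb P Y a := by
  intro ε hε
  obtain ⟨M, -, hM⟩ := h.exists_nonneg ha (half_pos hε)
  have hle' := hle.eventually (ge_mem_nhds (ENNReal.ofReal_pos.2 (half_pos hε)))
  refine ⟨C * M, (hM.and hle').mono fun n hn => ?_⟩
  calc P {ω | C * M * a n < |Y n ω|}
      ≤ P ({ω | M * a n < |X n ω|} ∪ {ω | ¬ |Y n ω| ≤ C * |X n ω|}) := by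
        refine measure_mono fun ω hω => ?_
        by_contra hcon
        simp only [Set.mem_union, Set.mem_ofPred_eq, not_or, not_lt, not_not] at hcon hω
        have := mul_le_mul_of_nonneg_left hcon.1 hC
        linarith [hcon.2]
    _ ≤ ENNReal.ofReal (ε / 2) + ENNReal.ofReal (ε / 2) :=
        (measure_union_le _ _).trans (add_le_add hn.1 hn.2)
    _ = ENNReal.ofReal ε := by
        rw [← ENNReal.ofReal_add (by linarith) (by linarith), add_halves]

lemma IsBigOInProb.mono_ae {C : ℝ} (h : IsBigOInProb P X a) (ha : ∀ n, 0 ≤ a n) (hC : 0 ≤ C)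
    (hle : ∀ n, ∀ᵐ ω ∂P, |Y n ω| ≤ C * |X n ω|) : IsBigOInProb P Y a :=
  h.mono_of_tendsto ha hC <| by
    have : (fun n => P {ω | ¬ |Y n ω| ≤ C * |X n ω|}) = fun _ => 0 := funext fun n => hle n
    rw [this]; exact tendsto_const_nhds

lemma IsBigOInProb.add (hX : IsBigOInProb P X a) (hY : IsBigOInProb P Y a) :
    IsBigOInProb P (fun n ω => |X n ω| + |Y n ω|) a := by
  intro ε hε
  obtain ⟨M, hM⟩ := hX _ (half_pos hε)
  obtain ⟨M', hM'⟩ := hY _ (half_pos hε)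
  refine ⟨M + M', (hM.and hM').mono fun n hn => ?_⟩
  calc P {ω | (M + M') * a n < |(|X n ω| + |Y n ω|)|}
      ≤ P ({ω | M * a n < |X n ω|} ∪ {ω | M' * a n < |Y n ω|}) := by
        refine measure_mono fun ω hω => ?_
        by_contra hcon
        simp only [Set.mem_union, Set.mem_ofPred_eq, not_or, not_lt] at hcon hω
        rw [abs_of_nonneg (by positivity)] at hω
        linarith [hcon.1, hcon.2]
    _ ≤ ENNReal.ofReal (ε / 2) + ENNReal.ofReal (ε / 2) :=
        (measure_union_le _ _).trans (add_le_add hn.1 hn.2)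
    _ = ENNReal.ofReal ε := by
        rw [← ENNReal.ofReal_add (by linarith) (by linarith), add_halves]

/-- A deterministic `O(a n)` sequence is `O_p(a n)`. -/
lemma isBigOInProb_of_isBigO {f : ℕ → ℝ} (h : f =O[atTop] a) (ha : ∀ n, 0 ≤ a n) :
    IsBigOInProb P (fun n _ => f n) a := by
  obtain ⟨C, hC⟩ := h.bound
  refine fun ε _ => ⟨C, hC.mono fun n hn => ?_⟩
  rw [Real.norm_eq_abs, Real.norm_eq_abs, abs_of_nonneg (ha n)] at hn
  simp [not_lt.2 hn]

/-- If `X n - c = O_p(a n)` with `a n → 0`, then `X n → c` in probability. -/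
lemma IsBigOInProb.tendstoInMeasure {E : Type*} [SeminormedAddCommGroup E] {f : ℕ → Ω → E} {c : E}
    (h : IsBigOInProb P (fun n ω => ‖f n ω - c‖) a) (ha : Tendsto a atTop (𝓝 0)) :
    TendstoInMeasure P f atTop (fun _ => c) := by
  rw [tendstoInMeasure_iff_norm]
  intro δ hδ
  rw [ENNReal.tendsto_nhds_zero]
  intro ε hε
  -- The tolerance lives in `ENNReal` and may be infinite, in which case any positive real serves.
  obtain ⟨ε', hε', hle⟩ : ∃ ε' : ℝ, 0 < ε' ∧ ENNReal.ofReal ε' ≤ ε := by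
    rcases eq_or_ne ε ⊤ with rfl | h'
    · exact ⟨1, one_pos, le_top⟩
    · exact ⟨ε.toReal, ENNReal.toReal_pos hε.ne' h', (ENNReal.ofReal_toReal h').le⟩
  obtain ⟨M, hM⟩ := h ε' hε'
  have h0 : Tendsto (fun n => M * a n) atTop (𝓝 0) := by simpa using ha.const_mul M
  filter_upwards [hM, h0.eventually (gt_mem_nhds hδ)] with n hn hlt
  refine (measure_mono fun ω hω => ?_).trans (hn.trans hle)
  simp only [Set.mem_ofPred_eq, abs_norm] at hω ⊢
  exact hlt.trans_le hω

/-- Continuous mapping with a constant limit: continuity at that one point is enough, which matters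
for matrix inversion. -/
lemma MeasureTheory.TendstoInMeasure.comp_continuousAt {E F : Type*} [PseudoEMetricSpace E]
    [PseudoEMetricSpace F] {f : ℕ → Ω → E} {c : E} {g : E → F}
    (h : TendstoInMeasure P f atTop (fun _ => c)) (hg : ContinuousAt g c) :
    TendstoInMeasure P (fun n ω => g (f n ω)) atTop (fun _ => g c) := by
  intro ε hε
  obtain ⟨δ, hδ, hball⟩ := Metric.nhds_basis_eball.mem_iff.1
    (hg (Metric.eball_mem_nhds (g c) hε))
  refine tendsto_of_tendsto_of_tendsto_of_le_of_le tendsto_const_nhds (h δ hδ)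
    (fun _ => zero_le) fun n => measure_mono fun ω hω => ?_
  by_contra hcon
  simp only [Set.mem_ofPred_eq, not_le] at hcon hω
  exact absurd (Metric.mem_eball.1 (hball (Metric.mem_eball.2 hcon))) (not_lt.2 hω)

lemma MeasureTheory.TendstoInMeasure.prodMk_const {E F : Type*} [PseudoEMetricSpace E]
    [PseudoEMetricSpace F] {f : ℕ → Ω → E} {g : ℕ → Ω → F} {c : E} {d : F}
    (hf : TendstoInMeasure P f atTop (fun _ => c)) (hg : TendstoInMeasure P g atTop (fun _ => d)) :
    TendstoInMeasure P (fun n ω => (f n ω, g n ω)) atTop (fun _ => (c, d)) := by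
  intro ε hε
  have := (hf ε hε).add (hg ε hε)
  rw [add_zero] at this
  refine tendsto_of_tendsto_of_tendsto_of_le_of_le tendsto_const_nhds this
    (fun _ => zero_le) fun n => (measure_mono fun ω hω => ?_).trans (measure_union_le _ _)
  simpa [Prod.edist_eq] using hω

lemma MeasureTheory.TendstoInMeasure.tendsto_measure_not {E : Type*} [PseudoEMetricSpace E]
    {f : ℕ → Ω → E} {c : E} (h : TendstoInMeasure P f atTop (fun _ => c)) {p : E → Prop}
    (hp : ∀ᶠ x in 𝓝 c, p x) :
    Tendsto (fun n => P {ω | ¬ p (f n ω)}) atTop (𝓝 0) := by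
  obtain ⟨δ, hδ, hball⟩ := Metric.nhds_basis_eball.mem_iff.1 hp
  refine tendsto_of_tendsto_of_tendsto_of_le_of_le tendsto_const_nhds (h δ hδ)
    (fun _ => zero_le) fun n => measure_mono fun ω hω => ?_
  by_contra hcon
  simp only [Set.mem_ofPred_eq, not_le] at hcon hω
  exact hω (hball (Metric.mem_eball.2 hcon))

/-- A sequence dominated, with probability tending to one, by a sequence tending to zero in
probability tends to zero in probability. -/
lemma tendstoInMeasure_zero_of_tendsto_measure {E : Type*} [SeminormedAddCommGroup E]
    {f : ℕ → Ω → E} {X : ℕ → Ω → ℝ} (hX : TendstoInMeasure P X atTop (fun _ => 0))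
    (h : Tendsto (fun n => P {ω | ¬ ‖f n ω‖ ≤ |X n ω|}) atTop (𝓝 0)) :
    TendstoInMeasure P f atTop (fun _ => 0) := by
  rw [tendstoInMeasure_iff_norm] at hX ⊢
  intro ε hε
  have := (hX ε hε).add h
  rw [add_zero] at this
  refine tendsto_of_tendsto_of_tendsto_of_le_of_le tendsto_const_nhds this
    (fun _ => zero_le) fun n => (measure_mono fun ω hω => ?_).trans (measure_union_le _ _)
  by_contra hcon
  simp only [Set.mem_union, Set.mem_ofPred_eq, not_or, not_le, sub_zero,
    Real.norm_eq_abs] at hcon hω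
  linarith [hcon.1, hcon.2]

/-- If `X n → 0` in probability and `Y n = O_p(1)`, then `X n * Y n → 0` in probability. -/
lemma MeasureTheory.TendstoInMeasure.mul_isBigOInProb
    (hX : TendstoInMeasure P X atTop (fun _ => 0)) (hY : IsBigOInProb P Y (fun _ => 1)) :
    TendstoInMeasure P (fun n ω => X n ω * Y n ω) atTop (fun _ => 0) := by
  rw [tendstoInMeasure_iff_norm] at hX ⊢
  intro δ hδ
  rw [ENNReal.tendsto_nhds_zero]
  intro ε hε
  obtain ⟨ε', hε', hle⟩ : ∃ ε' : ℝ, 0 < ε' ∧ ENNReal.ofReal ε' ≤ ε / 2 := by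
    rcases eq_or_ne ε ⊤ with rfl | h'
    · exact ⟨1, one_pos, by simp [ENNReal.top_div]⟩
    · refine ⟨(ε / 2).toReal, ENNReal.toReal_pos (ENNReal.half_pos hε.ne').ne' ?_,
        (ENNReal.ofReal_toReal ?_).le⟩ <;> exact ENNReal.div_ne_top h' two_ne_zero
  obtain ⟨M, hM0, hM⟩ := hY.exists_nonneg (fun _ => zero_le_one) hε'
  filter_upwards [hM, (ENNReal.tendsto_nhds_zero.1 (hX (δ / (M + 1)) (by positivity))) (ε / 2)
    (ENNReal.half_pos hε.ne')] with n hn hn'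
  calc _ ≤ P ({ω | M * 1 < |Y n ω|} ∪ {ω | δ / (M + 1) ≤ ‖X n ω - 0‖}) := by
        refine measure_mono fun ω hω => ?_
        by_contra hcon
        simp only [Set.mem_union, Set.mem_ofPred_eq, not_or, not_le, not_lt, sub_zero,
          Real.norm_eq_abs, abs_mul, mul_one] at hcon hω
        rw [lt_div_iff₀ (by positivity)] at hcon
        have := mul_le_mul_of_nonneg_left hcon.1 (abs_nonneg (X n ω))
        nlinarith [hcon.2, abs_nonneg (X n ω)]
    _ ≤ ε / 2 + ε / 2 := (measure_union_le _ _).trans (add_le_add (hn.trans hle) hn')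
    _ = ε := ENNReal.add_halves ε

/-- Bounded convergence along convergence in probability to a constant. -/
lemma MeasureTheory.TendstoInMeasure.tendsto_integral_comp [IsProbabilityMeasure P] {c : ℝ}
    (h : TendstoInMeasure P X atTop (fun _ => c)) (hX : ∀ n, AEMeasurable (X n) P)
    (f : BoundedContinuousFunction ℝ ℝ) :
    Tendsto (fun n => ∫ ω, f (X n ω) ∂P) atTop (𝓝 (f c)) := by
  have h1 := (h.tendstoInDistribution hX).tendsto
  have h2 := (ProbabilityMeasure.tendsto_iff_forall_integral_tendsto.1 h1) f
  simp only [ProbabilityMeasure.coe_mk] at h2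
  simpa [integral_map (hX _) f.continuous.aestronglyMeasurable,
    integral_map aemeasurable_const f.continuous.aestronglyMeasurable] using h2

lemma tendsto_rootRate : Tendsto rootRate atTop (𝓝 0) :=
  (Real.tendsto_sqrt_atTop.comp tendsto_natCast_atTop_atTop).inv_tendsto_atTop

lemma rootRate_nonneg (n : ℕ) : 0 ≤ rootRate n := inv_nonneg.2 (Real.sqrt_nonneg _)

end StochasticOrder

/-! ### Continuity and measurability of the matrix inverse. -/

lemma Matrix.PosDef.continuousAt_inv {m : Type*} [Fintype m] [DecidableEq m] {A : Matrix m m ℝ}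
    (hA : A.PosDef) : ContinuousAt (fun B : Matrix m m ℝ => B⁻¹) A := by
  have h0 : A.det ≠ 0 := hA.det_pos.ne'
  simp only [Matrix.inv_def, Ring.inverse_eq_inv']
  exact (ContinuousAt.inv₀ (by fun_prop) h0).smul (by fun_prop)

lemma Measurable.matrix_det {Ω m : Type*} [MeasurableSpace Ω] [Fintype m] [DecidableEq m] {A : Ω → Matrix m m ℝ}
    (hA : ∀ a c, Measurable fun ω => A ω a c) : Measurable fun ω => (A ω).det := by
  simp only [Matrix.det_apply]
  exact Finset.measurable_fun_sum _ fun σ _ =>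
    (Finset.measurable_fun_prod _ fun i _ => hA _ _).const_smul _

/-- By Cramer's formula each entry is a cofactor times `det⁻¹`. The convention `0⁻¹ = 0` keeps this
measurable on singular matrices too, so invertibility is not needed. -/
lemma Measurable.matrix_inv_apply {Ω m : Type*} [MeasurableSpace Ω] [Fintype m] [DecidableEq m] {A : Ω → Matrix m m ℝ}
    (hA : ∀ a c, Measurable fun ω => A ω a c) (a c : m) : Measurable fun ω => (A ω)⁻¹ a c := by
  simp only [Matrix.inv_def, Ring.inverse_eq_inv', Matrix.smul_apply, Matrix.adjugate_apply,
    smul_eq_mul]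
  refine (Measurable.matrix_det hA).inv.mul (Measurable.matrix_det fun k l => ?_)
  by_cases hk : k = c
  · subst hk
    simp
  · simpa [Matrix.updateRow_ne hk] using hA k l

/-! ### Elementary consequences of the categorical model. -/

namespace RCData

section Deterministic

variable {Ω : Type*} {p : ℕ}

@[simp] lemma w_zero (D : RCData Ω p) (i : ℕ) (ω : Ω) : D.w i ω 0 = D.x i ω := rfl

lemma abs_w_le (D : RCData Ω p) (i : ℕ) (ω : Ω) (a : Fin (p + 1)) : |D.w i ω a| ≤ ‖D.w i ω‖ :=
  PiLp.norm_apply_le (D.w i ω) a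

lemma abs_x_le (D : RCData Ω p) (i : ℕ) (ω : Ω) : |D.x i ω| ≤ ‖D.w i ω‖ := D.abs_w_le i ω 0

lemma Qn_mulVec (D : RCData Ω p) (n : ℕ) (ω : Ω) (v : Fin (p + 1) → ℝ) :
    D.Qn n ω *ᵥ v = (n : ℝ)⁻¹ • ∑ i ∈ Finset.range n, (D.w i ω ⬝ᵥ v) • (D.w i ω).ofLp := by
  rw [Qn, Matrix.smul_mulVec, Matrix.sum_mulVec]
  congr 1
  refine Finset.sum_congr rfl fun i _ => ?_
  rw [Matrix.vecMulVec_mulVec]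
  ext a
  simp [mul_comm]

end Deterministic

variable {Ω : Type*} [MeasurableSpace Ω] {P : Measure Ω} {p K : ℕ} {D : RCData Ω p}
  {b π : Fin K → ℝ}

namespace IsCategoricalModel

/-- A single category would need weight one. The bound is what turns the moment orders `2K - 1` and
`4K - 2` into at least 3 for `u` and 6 for `w`, as the third-moment bound for the scores requires.
-/
lemma two_le (h : D.IsCategoricalModel P b π) : 2 ≤ K := by
  have h1 := h.weight_sum
  by_contra hK
  obtain rfl | rfl : K = 0 ∨ K = 1 := by omega
  · simp at h1
  · have := (h.weight_mem 0).2
    simp at h1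
    linarith

lemma measurable_w (h : D.IsCategoricalModel P b π) (i : ℕ) : Measurable (D.w i) := by
  refine (WithLp.measurable_toLp 2 _).comp (measurable_pi_iff.2 fun a => ?_)
  refine Fin.cases ?_ (fun j => ?_) a
  · simpa using h.measurable_x i
  · have := h.measurable_z i
    simp only [Fin.cons_succ]
    fun_prop

lemma measurable_w_apply (h : D.IsCategoricalModel P b π) (i : ℕ) (a : Fin (p + 1)) :
    Measurable (fun ω => D.w i ω a) :=
  (measurable_pi_apply a).comp ((WithLp.measurable_ofLp 2 _).comp (h.measurable_w i))

/-- The atoms are disjoint because the support points are distinct, and their masses already sum to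
one. -/
lemma ae_exists_eq [IsProbabilityMeasure P] (h : D.IsCategoricalModel P b π) (i : ℕ) :
    ∀ᵐ ω ∂P, ∃ k, D.β i ω = b k := by
  have hms : ∀ k, MeasurableSet {ω | D.β i ω = b k} := fun k =>
    measurableSet_eq_fun (h.measurable_β i) measurable_const
  have h1 : P (⋃ k, {ω | D.β i ω = b k}) = 1 := by
    rw [measure_iUnion _ hms, tsum_fintype]
    · simp_rw [h.β_dist]
      rw [← ENNReal.ofReal_sum_of_nonneg (fun k _ => (h.weight_mem k).1.le), h.weight_sum,
        ENNReal.ofReal_one]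
    · intro k l hkl
      refine Set.disjoint_left.2 fun ω hω hω' => hkl (h.strictMono_b.injective ?_)
      simp only [Set.mem_ofPred_eq] at hω hω'
      rw [← hω, hω']
  have h2 := (prob_compl_eq_zero_iff (MeasurableSet.iUnion hms)).2 h1
  rw [measure_eq_zero_iff_ae_notMem] at h2
  filter_upwards [h2] with ω hω
  simpa using hω

lemma integral_β [IsProbabilityMeasure P] (h : D.IsCategoricalModel P b π) (i : ℕ) :
    ∫ ω, D.β i ω ∂P = ∑ k, π k * b k := by
  have hms : ∀ k, MeasurableSet {ω | D.β i ω = b k} := fun k =>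
    measurableSet_eq_fun (h.measurable_β i) measurable_const
  have h1 : D.β i =ᵐ[P] fun ω => ∑ k, {ω | D.β i ω = b k}.indicator (fun _ => b k) ω := by
    filter_upwards [h.ae_exists_eq i] with ω ⟨k, hk⟩
    rw [Finset.sum_eq_single k]
    · simp [Set.indicator, hk]
    · intro l _ hl
      simp [Set.indicator, hk, h.strictMono_b.injective.eq_iff, hl.symm]
    · simp
  rw [integral_congr_ae h1, integral_finsetSum]
  · refine Finset.sum_congr rfl fun k _ => ?_
    rw [integral_indicator_const _ (hms k), measureReal_def, h.β_dist,
      ENNReal.toReal_ofReal (h.weight_mem k).1.le, smul_eq_mul]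
  · exact fun k _ => (integrable_const _).indicator (hms k)

/-- Finite support makes the centred coefficients bounded by one constant for all `i`, so no moment
condition on them is ever needed. -/
lemma exists_bound [IsProbabilityMeasure P] (h : D.IsCategoricalModel P b π) :
    ∃ B : ℝ, 0 ≤ B ∧ ∀ i, ∀ᵐ ω ∂P, |D.β i ω - ∫ ω', D.β i ω' ∂P| ≤ B := by
  refine ⟨∑ l, |b l - ∑ k, π k * b k|, by positivity, fun i => ?_⟩
  filter_upwards [h.ae_exists_eq i] with ω ⟨k, hk⟩
  rw [h.integral_β, hk]
  exact Finset.single_le_sum (f := fun l => |b l - ∑ k, π k * b k|) (fun _ _ => abs_nonneg _)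
    (Finset.mem_univ k)

lemma measurable_xi (h : D.IsCategoricalModel P b π) (i : ℕ) : Measurable (D.xi P i) := by
  have := h.measurable_x i
  have := h.measurable_β i
  have := h.measurable_u i
  unfold xi
  fun_prop

end IsCategoricalModel

/-- The score `n⁻¹ ∑ w_i ξ_i`. -/
noncomputable def score (D : RCData Ω p) (P : Measure Ω) (n : ℕ) (ω : Ω) :
    EuclideanSpace ℝ (Fin (p + 1)) :=
  (n : ℝ)⁻¹ • ∑ i ∈ Finset.range n, D.xi P i ω • D.w i ω

/-! ### Population normal equations and the root-n rate. -/

lemma y_eq [IsProbabilityMeasure P] (h : D.IsCategoricalModel P b π) (i : ℕ) (ω : Ω) :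
    D.y i ω = (D.w i ω ⬝ᵥ D.phi P) + D.xi P i ω := by
  have h1 : (D.w i ω ⬝ᵥ D.phi P) = D.x i ω * (∫ ω, D.β 0 ω ∂P) + (D.z i ω ⬝ᵥ D.γ) := by
    simp [dotProduct, Fin.sum_univ_succ, w, phi]
  rw [h1, y, xi, h.integral_β i, h.integral_β 0]
  ring

lemma qn_eq [IsProbabilityMeasure P] (h : D.IsCategoricalModel P b π) (n : ℕ) (ω : Ω) :
    D.qn n ω = WithLp.toLp 2 (D.Qn n ω *ᵥ D.phi P) + D.score P n ω := by
  ext a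
  simp only [qn, Qn_mulVec, score, y_eq h]
  simp [Finset.sum_apply, add_mul, Finset.sum_add_distrib, mul_add]

variable {Qww : Matrix (Fin (p + 1)) (Fin (p + 1)) ℝ} {qwy : EuclideanSpace ℝ (Fin (p + 1))}

lemma integrable_norm_w_pow (h : D.IsCategoricalModel P b π) (hr : D.Regular P K Qww qwy) (i : ℕ)
    {r : ℕ} (h1 : 1 ≤ r) (h6 : r ≤ 6) : Integrable (fun ω => ‖D.w i ω‖ ^ r) P := by
  obtain ⟨C, hC⟩ := hr.w_moments
  have := h.two_le
  exact (hC i r (Finset.mem_Icc.2 ⟨h1, by omega⟩)).1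

lemma integrable_w_apply (h : D.IsCategoricalModel P b π) (hr : D.Regular P K Qww qwy) (i : ℕ)
    (a : Fin (p + 1)) : Integrable (fun ω => D.w i ω a) P := by
  refine (integrable_norm_w_pow h hr i le_rfl (by norm_num)).mono'
    (h.measurable_w_apply i a).aestronglyMeasurable (ae_of_all _ fun ω => ?_)
  simpa using D.abs_w_le i ω a

lemma integrable_w_mul_w (h : D.IsCategoricalModel P b π) (hr : D.Regular P K Qww qwy) (i : ℕ)
    (a c : Fin (p + 1)) : Integrable (fun ω => D.w i ω a * D.w i ω c) P := by
  refine (integrable_norm_w_pow h hr i (r := 2) (by norm_num) (by norm_num)).mono'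
    ((h.measurable_w_apply i a).mul (h.measurable_w_apply i c)).aestronglyMeasurable (ae_of_all _ fun ω => ?_)
  rw [Real.norm_eq_abs, abs_mul, sq]
  exact mul_le_mul (D.abs_w_le i ω a) (D.abs_w_le i ω c) (abs_nonneg _) (norm_nonneg _)

lemma integrable_u (h : D.IsCategoricalModel P b π) (hr : D.Regular P K Qww qwy) (i : ℕ) :
    Integrable (D.u i) P := by
  obtain ⟨C, hC⟩ := hr.u_moments
  have := h.two_le
  have h1 := (hC i 1 (Finset.mem_Icc.2 ⟨le_rfl, by omega⟩)).1
  have hm := h.measurable_u i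
  exact h1.mono' (by fun_prop) (ae_of_all _ fun ω => by simp)

lemma indepFun_u_w (hr : D.Regular P K Qww qwy) (i : ℕ) :
    IndepFun (D.u i) (D.w i) P :=
  (hr.u_indep i).comp measurable_id measurable_fst

/-- Split `ξ_i w_i` into `u_i w_i` and `(β_i - E β_i) x_i w_i`. Each is a product of a centred
variable with an independent function of `w_i`. -/
lemma integrable_xi_mul_w [IsProbabilityMeasure P] (h : D.IsCategoricalModel P b π)
    (hr : D.Regular P K Qww qwy) (i : ℕ) (a : Fin (p + 1)) :
    Integrable (fun ω => D.xi P i ω * D.w i ω a) P ∧ ∫ ω, D.xi P i ω * D.w i ω a ∂P = 0 := by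
  have hmw := (h.measurable_w_apply i a).aestronglyMeasurable (μ := P)
  have hmw2 := ((h.measurable_w_apply i 0).mul (h.measurable_w_apply i a)).aestronglyMeasurable
    (μ := P)
  have hmu := h.measurable_u i
  have hmβ := h.measurable_β i
  have hmx := h.measurable_x i
  obtain ⟨B, -, hB⟩ := h.exists_bound
  have hind : IndepFun (D.u i) (fun ω => D.w i ω a) P :=
    (indepFun_u_w hr i).comp (φ := id) (ψ := fun v : EuclideanSpace ℝ (Fin (p + 1)) => v a) measurable_id (by fun_prop)
  have hind2 : IndepFun (fun ω => D.β i ω - ∫ ω', D.β i ω' ∂P)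
      (fun ω => D.w i ω 0 * D.w i ω a) P :=
    (h.β_indep_w i).comp (φ := fun t => t - ∫ ω', D.β i ω' ∂P) 
      (ψ := fun v : EuclideanSpace ℝ (Fin (p + 1)) => v 0 * v a) (by fun_prop) (by fun_prop)
  have hβ : Integrable (fun ω => D.β i ω - ∫ ω', D.β i ω' ∂P) P :=
    (integrable_const B).mono' (by fun_prop) (hB i)
  have hβi : Integrable (D.β i) P := by
    refine (hβ.add (integrable_const (∫ ω', D.β i ω' ∂P))).congr (ae_of_all _ fun ω => ?_)
    simp
  have hint1 : Integrable (fun ω => D.u i ω * D.w i ω a) P :=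
    hind.integrable_mul (integrable_u h hr i) (integrable_w_apply h hr i a)
  have hint2 : Integrable (fun ω => (D.β i ω - ∫ ω', D.β i ω' ∂P) * (D.w i ω 0 * D.w i ω a)) P :=
    hind2.integrable_mul hβ (integrable_w_mul_w h hr i 0 a)
  have heq : (fun ω => D.xi P i ω * D.w i ω a) = fun ω => D.u i ω * D.w i ω a +
      (D.β i ω - ∫ ω', D.β i ω' ∂P) * (D.w i ω 0 * D.w i ω a) := by
    ext ω
    rw [xi, w_zero]
    ring
  rw [heq]
  refine ⟨hint1.add hint2, ?_⟩
  rw [integral_add hint1 hint2,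
    hind.integral_fun_mul_eq_mul_integral (by fun_prop) hmw,
    hind2.integral_fun_mul_eq_mul_integral (by fun_prop) hmw2, h.u_mean,
    integral_sub hβi (integrable_const _)]
  simp

lemma Eqn_eq [IsProbabilityMeasure P] (h : D.IsCategoricalModel P b π)
    (hr : D.Regular P K Qww qwy) (n : ℕ) :
    D.Eqn P n = WithLp.toLp 2 (D.EQn P n *ᵥ D.phi P) := by
  have hQ : ∀ a c, Integrable (fun ω => D.Qn n ω a c) P := by
    intro a c
    simp only [Qn, Matrix.smul_apply, Matrix.sum_apply, Matrix.vecMulVec_apply]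
    exact (integrable_finsetSum _ fun i _ => integrable_w_mul_w h hr i a c).const_mul _
  have hs : ∀ a, Integrable (fun ω => D.score P n ω a) P ∧ ∫ ω, D.score P n ω a ∂P = 0 := by
    intro a
    simp only [score, PiLp.smul_apply, WithLp.ofLp_sum, Finset.sum_apply, WithLp.ofLp_smul,
      Pi.smul_apply, smul_eq_mul]
    refine ⟨(integrable_finsetSum _ fun i _ => (integrable_xi_mul_w h hr i a).1).const_mul _, ?_⟩
    rw [integral_const_mul, integral_finsetSum _ fun i _ => (integrable_xi_mul_w h hr i a).1,
      Finset.sum_eq_zero fun i _ => (integrable_xi_mul_w h hr i a).2, mul_zero]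
  ext a
  simp only [Eqn, qn_eq h, PiLp.add_apply, Matrix.mulVec, dotProduct, EQn, Matrix.of_apply]
  rw [integral_add _ (hs a).1, (hs a).2, add_zero, integral_finsetSum]
  · exact Finset.sum_congr rfl fun c _ => integral_mul_const _ _
  · exact fun c _ => (hQ a c).mul_const _
  · exact integrable_finsetSum _ fun c _ => (hQ a c).mul_const _

/-- Subtracting the population normal equations expresses the score through the two deviations whose
rates are assumed. -/
lemma score_eq [IsProbabilityMeasure P] (h : D.IsCategoricalModel P b π)
    (hr : D.Regular P K Qww qwy) (n : ℕ) (ω : Ω) :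
    D.score P n ω = (D.qn n ω - D.Eqn P n) -
      WithLp.toLp 2 ((D.Qn n ω - D.EQn P n) *ᵥ D.phi P) := by
  rw [Eqn_eq h hr, qn_eq h, Matrix.sub_mulVec, WithLp.toLp_sub]
  abel

lemma score_rate [IsProbabilityMeasure P] (h : D.IsCategoricalModel P b π)
    (hr : D.Regular P K Qww qwy) :
    IsBigOInProb P (fun n ω => ‖D.score P n ω‖) rootRate := by
  have h1 : IsBigOInProb P (fun n ω => ‖D.phi P‖ * ‖D.Qn n ω - D.EQn P n‖) rootRate :=
    hr.Qn_rate.mono_ae (C := ‖D.phi P‖) rootRate_nonneg (norm_nonneg _)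
      fun n => ae_of_all _ fun ω => by simp
  refine (hr.qn_rate.add h1).mono_ae (C := 1) rootRate_nonneg zero_le_one
    fun n => ae_of_all _ fun ω => ?_
  rw [score_eq h hr, one_mul, abs_norm, abs_norm, abs_of_nonneg (by positivity),
    abs_of_nonneg (by positivity)]
  refine (norm_sub_le _ _).trans (add_le_add_right ?_ _)
  rw [mul_comm]
  exact Matrix.l2_opNorm_mulVec _ _

lemma tendstoInMeasure_Qn (hr : D.Regular P K Qww qwy) :
    TendstoInMeasure P D.Qn atTop (fun _ => Qww) := by
  refine IsBigOInProb.tendstoInMeasure (a := rootRate) ?_ tendsto_rootRate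
  refine (hr.Qn_rate.add (isBigOInProb_of_isBigO hr.EQn_rate rootRate_nonneg)).mono_ae (C := 1)
    rootRate_nonneg zero_le_one fun n => ae_of_all _ fun ω => ?_
  rw [one_mul, abs_norm, abs_norm, abs_norm, abs_of_nonneg (by positivity)]
  exact norm_sub_le_norm_sub_add_norm_sub _ _ _

lemma tendstoInMeasure_Qn_inv (hr : D.Regular P K Qww qwy) :
    TendstoInMeasure P (fun n ω => (D.Qn n ω)⁻¹) atTop (fun _ => Qww⁻¹) :=
  (tendstoInMeasure_Qn hr).comp_continuousAt (hr.Qww_posDef.continuousAt_inv)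

lemma phiHat_sub_phi [IsProbabilityMeasure P] (h : D.IsCategoricalModel P b π) {n : ℕ} {ω : Ω}
    (hdet : (D.Qn n ω).det ≠ 0) :
    D.phiHat n ω - D.phi P = WithLp.toLp 2 ((D.Qn n ω)⁻¹ *ᵥ D.score P n ω) := by
  have h1 : (D.Qn n ω)⁻¹ *ᵥ (D.Qn n ω *ᵥ D.phi P) = D.phi P := by
    rw [Matrix.mulVec_mulVec, Matrix.nonsing_inv_mul _ (isUnit_iff_ne_zero.2 hdet),
      Matrix.one_mulVec]
  rw [phiHat, qn_eq h]
  ext a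
  simp [Matrix.mulVec_add, h1]

/-- Invertibility and this bound on the inverse hold throughout a neighbourhood of the positive
definite limit `Qww`. -/
lemma tendsto_measure_bad_Qn (hr : D.Regular P K Qww qwy) :
    Tendsto (fun n => P {ω | ¬ ((D.Qn n ω).det ≠ 0 ∧ ‖(D.Qn n ω)⁻¹‖ ≤ ‖Qww⁻¹‖ + 1)})
      atTop (𝓝 0) := by
  refine (tendstoInMeasure_Qn hr).tendsto_measure_not
    (p := fun A => A.det ≠ 0 ∧ ‖A⁻¹‖ ≤ ‖Qww⁻¹‖ + 1) ?_
  have h1 : ContinuousAt (fun A : Matrix (Fin (p + 1)) (Fin (p + 1)) ℝ => A.det) Qww := by fun_prop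
  have h2 := (hr.Qww_posDef.continuousAt_inv).norm
  exact (h1.eventually_ne hr.Qww_posDef.det_pos.ne').and
    ((h2.eventually (gt_mem_nhds (lt_add_one _))).mono fun _ => le_of_lt)

lemma phiHat_rate [IsProbabilityMeasure P] (h : D.IsCategoricalModel P b π)
    (hr : D.Regular P K Qww qwy) :
    IsBigOInProb P (fun n ω => ‖D.phiHat n ω - D.phi P‖) rootRate := by
  refine (score_rate h hr).mono_of_tendsto (C := ‖Qww⁻¹‖ + 1) rootRate_nonneg (by positivity) ?_
  refine tendsto_of_tendsto_of_tendsto_of_le_of_le tendsto_const_nhds (tendsto_measure_bad_Qn hr)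
    (fun _ => zero_le) fun n => measure_mono fun ω hω => ?_
  simp only [Set.mem_ofPred_eq] at hω ⊢
  contrapose! hω
  rw [phiHat_sub_phi h hω.1, abs_norm, abs_norm]
  exact (Matrix.l2_opNorm_mulVec _ _).trans (mul_le_mul_of_nonneg_right hω.2 (norm_nonneg _))

end RCData

/-! ### Consistency of the sandwich variance estimator. -/

lemma Matrix.l2_opNorm_vecMulVec_le {m : Type*} [Fintype m] [DecidableEq m]
    (v w : EuclideanSpace ℝ m) : ‖Matrix.vecMulVec v.ofLp w.ofLp‖ ≤ ‖v‖ * ‖w‖ := by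
  rw [Matrix.l2_opNorm_def]
  refine ContinuousLinearMap.opNorm_le_bound _ (by positivity) fun x => ?_
  have h1 : (LinearMap.toContinuousLinearMap (Matrix.toEuclideanLin (Matrix.vecMulVec v.ofLp w.ofLp))) x
      = (inner ℝ w x) • v := by
    ext a
    simp [Matrix.toEuclideanLin, Matrix.vecMulVec_mulVec, EuclideanSpace.inner_eq_star_dotProduct,
      dotProduct_comm, mul_comm]
  have h2 := norm_inner_le_norm (𝕜 := ℝ) w x
  calc _ = ‖(inner ℝ w x : ℝ)‖ * ‖v‖ := by rw [← norm_smul, ← h1]; rfl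
    _ ≤ ‖w‖ * ‖x‖ * ‖v‖ := mul_le_mul_of_nonneg_right h2 (norm_nonneg _)
    _ = _ := by ring

lemma abs_dotProduct_le_norm_mul_norm {m : Type*} [Fintype m] (v w : EuclideanSpace ℝ m) :
    |v ⬝ᵥ w| ≤ ‖v‖ * ‖w‖ := by
  have := abs_real_inner_le_norm v w
  rwa [EuclideanSpace.inner_eq_star_dotProduct, star_trivial, dotProduct_comm] at this

namespace RCData

variable {Ω : Type*} [MeasurableSpace Ω] {P : Measure Ω} {p K : ℕ} {D : RCData Ω p}
  {b π : Fin K → ℝ} {Qww Vwξ : Matrix (Fin (p + 1)) (Fin (p + 1)) ℝ}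
  {qwy : EuclideanSpace ℝ (Fin (p + 1))}

lemma xiHat_eq [IsProbabilityMeasure P] (h : D.IsCategoricalModel P b π) (n i : ℕ) (ω : Ω) :
    D.xiHat n i ω = D.xi P i ω - ((D.w i ω).ofLp ⬝ᵥ (D.phiHat n ω - D.phi P).ofLp) := by
  rw [xiHat, y_eq h, WithLp.ofLp_sub, dotProduct_sub]
  ring

/-- Since `ξ̂_i = ξ_i - w_i'δ` with `δ = φ̂ - φ`, the difference of squares is `-2 ξ_i w_i'δ +
(w_i'δ)²`. Bounding `|ξ_i|` by `|u_i| + B‖w_i‖` leaves only fourth-order terms in `w_i` and `u_i`.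
The constant `3 + 2B` is a roomy common bound for both powers of `‖δ‖`. -/
lemma norm_VwHat_sub_Vn_le [IsProbabilityMeasure P] (h : D.IsCategoricalModel P b π) {B : ℝ}
    (hB0 : 0 ≤ B) {ω : Ω} (hB : ∀ i, |D.β i ω - ∫ ω', D.β i ω' ∂P| ≤ B) (n : ℕ) :
    ‖D.VwHat n ω - D.Vn P n ω‖ ≤
      (‖D.phiHat n ω - D.phi P‖ + ‖D.phiHat n ω - D.phi P‖ ^ 2) *
        ((3 + 2 * B) * ((n : ℝ)⁻¹ * ∑ i ∈ Finset.range n, ‖D.w i ω‖ ^ 4 +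
          (n : ℝ)⁻¹ * ∑ i ∈ Finset.range n, D.u i ω ^ 4)) := by
  set δ := D.phiHat n ω - D.phi P
  have hterm : ∀ i, ‖(D.xiHat n i ω ^ 2 - D.xi P i ω ^ 2) •
      Matrix.vecMulVec (D.w i ω).ofLp (D.w i ω).ofLp‖ ≤
      (‖δ‖ + ‖δ‖ ^ 2) * ((3 + 2 * B) * (‖D.w i ω‖ ^ 4 + D.u i ω ^ 4)) := by
    intro i
    set W := ‖D.w i ω‖
    have hW : 0 ≤ W := norm_nonneg _
    have hδ : 0 ≤ ‖δ‖ := norm_nonneg _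
    have hdot : |D.w i ω ⬝ᵥ δ| ≤ W * ‖δ‖ := abs_dotProduct_le_norm_mul_norm _ _
    have hxi : |D.xi P i ω| ≤ |D.u i ω| + W * B := by
      rw [xi]
      refine (abs_add_le _ _).trans (add_le_add_right ?_ _)
      rw [abs_mul]
      exact mul_le_mul (D.abs_x_le i ω) (hB i) (abs_nonneg _) hW
    have hsq : |D.xiHat n i ω ^ 2 - D.xi P i ω ^ 2| ≤
        2 * (|D.u i ω| + W * B) * (W * ‖δ‖) + (W * ‖δ‖) ^ 2 := by
      rw [xiHat_eq (P := P) h, show (D.xi P i ω - D.w i ω ⬝ᵥ δ) ^ 2 - D.xi P i ω ^ 2 =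
        -(2 * D.xi P i ω * (D.w i ω ⬝ᵥ δ)) + (D.w i ω ⬝ᵥ δ) ^ 2 by ring]
      refine (abs_add_le _ _).trans (add_le_add ?_ ?_)
      · rw [abs_neg, abs_mul, abs_mul, abs_two]
        gcongr
      · rw [abs_pow]
        gcongr
    have hy : W ^ 3 * |D.u i ω| ≤ W ^ 4 + D.u i ω ^ 4 := by
      rw [show D.u i ω ^ 4 = |D.u i ω| ^ 4 from (Even.pow_abs (by decide) _).symm]
      have hu := abs_nonneg (D.u i ω)
      -- The mixed term is at most the fourth power of the larger factor.
      rcases le_total W |D.u i ω| with hle | hle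
      · calc W ^ 3 * |D.u i ω| ≤ |D.u i ω| ^ 3 * |D.u i ω| := by gcongr
          _ = |D.u i ω| ^ 4 := by ring
          _ ≤ _ := le_add_of_nonneg_left (by positivity)
      · calc W ^ 3 * |D.u i ω| ≤ W ^ 3 * W := by gcongr
          _ = W ^ 4 := by ring
          _ ≤ _ := le_add_of_nonneg_right (by positivity)
    have hu4 : 0 ≤ D.u i ω ^ 4 := by positivity
    rw [norm_smul, Real.norm_eq_abs]
    calc _ ≤ (2 * (|D.u i ω| + W * B) * (W * ‖δ‖) + (W * ‖δ‖) ^ 2) * (W * W) :=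
          mul_le_mul hsq (Matrix.l2_opNorm_vecMulVec_le _ _) (norm_nonneg _) (by positivity)
      _ = ‖δ‖ * (2 * (W ^ 3 * |D.u i ω|) + 2 * B * W ^ 4) + ‖δ‖ ^ 2 * W ^ 4 := by ring
      _ ≤ ‖δ‖ * ((3 + 2 * B) * (W ^ 4 + D.u i ω ^ 4)) +
          ‖δ‖ ^ 2 * ((3 + 2 * B) * (W ^ 4 + D.u i ω ^ 4)) := by
          have h4 : 0 ≤ W ^ 4 := by positivity
          have hBu : 0 ≤ B * D.u i ω ^ 4 := by positivity
          have hBw : 0 ≤ B * W ^ 4 := by positivity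
          gcongr <;> nlinarith
      _ = _ := by ring
  have heq : D.VwHat n ω - D.Vn P n ω = (n : ℝ)⁻¹ • ∑ i ∈ Finset.range n,
      (D.xiHat n i ω ^ 2 - D.xi P i ω ^ 2) •
        Matrix.vecMulVec (D.w i ω).ofLp (D.w i ω).ofLp := by
    simp only [VwHat, Vn, sub_smul, Finset.sum_sub_distrib, smul_sub]
  have hn : (0 : ℝ) ≤ (n : ℝ)⁻¹ := by positivity
  rw [heq, norm_smul, Real.norm_of_nonneg hn]
  calc _ ≤ (n : ℝ)⁻¹ * ∑ i ∈ Finset.range n,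
        (‖δ‖ + ‖δ‖ ^ 2) * ((3 + 2 * B) * (‖D.w i ω‖ ^ 4 + D.u i ω ^ 4)) :=
        mul_le_mul_of_nonneg_left (norm_sum_le_of_le _ fun i _ => hterm i) hn
    _ = _ := by
        rw [← Finset.mul_sum, ← Finset.mul_sum, Finset.sum_add_distrib]
        ring

lemma tendstoInMeasure_phiHat [IsProbabilityMeasure P] (h : D.IsCategoricalModel P b π)
    (hr : D.Regular P K Qww qwy) :
    TendstoInMeasure P D.phiHat atTop (fun _ => D.phi P) :=
  (phiHat_rate h hr).tendstoInMeasure tendsto_rootRate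

lemma tendstoInMeasure_Vn (hs : D.ScoreRegular P Vwξ) :
    TendstoInMeasure P (D.Vn P) atTop (fun _ => Vwξ) := by
  refine IsBigOInProb.tendstoInMeasure (a := rootRate) ?_ tendsto_rootRate
  refine (hs.Vn_rate.add (isBigOInProb_of_isBigO hs.EVn_rate rootRate_nonneg)).mono_ae (C := 1)
    rootRate_nonneg zero_le_one fun n => ae_of_all _ fun ω => ?_
  rw [one_mul, abs_norm, abs_norm, abs_norm, abs_of_nonneg (by positivity)]
  exact norm_sub_le_norm_sub_add_norm_sub _ _ _

lemma tendstoInMeasure_VwHat [IsProbabilityMeasure P] (h : D.IsCategoricalModel P b π)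
    (hr : D.Regular P K Qww qwy) (hs : D.ScoreRegular P Vwξ) :
    TendstoInMeasure P D.VwHat atTop (fun _ => Vwξ) := by
  obtain ⟨B, hB0, hB⟩ := h.exists_bound
  have hδ : TendstoInMeasure P (fun n ω => ‖D.phiHat n ω - D.phi P‖ +
      ‖D.phiHat n ω - D.phi P‖ ^ 2) atTop (fun _ => 0) := by
    have hg : Continuous fun v : EuclideanSpace ℝ (Fin (p + 1)) =>
      ‖v - D.phi P‖ + ‖v - D.phi P‖ ^ 2 := by fun_prop
    have := (tendstoInMeasure_phiHat h hr).comp_continuousAt hg.continuousAt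
    simpa only [sub_self, norm_zero, zero_pow two_ne_zero, add_zero] using this
  have hO : IsBigOInProb P (fun n ω => (3 + 2 * B) * ((n : ℝ)⁻¹ * ∑ i ∈ Finset.range n,
      ‖D.w i ω‖ ^ 4 + (n : ℝ)⁻¹ * ∑ i ∈ Finset.range n, D.u i ω ^ 4)) (fun _ => 1) := by
    refine (hr.w_fourth.add hr.u_fourth).mono_ae (C := 3 + 2 * B) (fun _ => zero_le_one)
      (by positivity) fun n => ae_of_all _ fun ω => ?_
    rw [abs_mul, abs_of_nonneg (by positivity : 0 ≤ 3 + 2 * B)]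
    refine mul_le_mul_of_nonneg_left ?_ (by positivity)
    exact (abs_add_le _ _).trans (le_abs_self _)
  have hdiff : TendstoInMeasure P (fun n ω => D.VwHat n ω - D.Vn P n ω) atTop (fun _ => 0) := by
    refine tendstoInMeasure_zero_of_tendsto_measure (hδ.mul_isBigOInProb hO) ?_
    refine tendsto_const_nhds.congr fun n => Eq.symm ?_
    change ∀ᵐ ω ∂P, _
    filter_upwards [ae_all_iff.2 hB] with ω hω
    exact (norm_VwHat_sub_Vn_le h hB0 hω n).trans (le_abs_self _)
  have hg : Continuous fun q : Matrix (Fin (p + 1)) (Fin (p + 1)) ℝ ×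
      Matrix (Fin (p + 1)) (Fin (p + 1)) ℝ => q.1 + q.2 := by fun_prop
  have := (hdiff.prodMk_const (tendstoInMeasure_Vn hs)).comp_continuousAt hg.continuousAt
  simpa only [sub_add_cancel, zero_add] using this

lemma tendstoInMeasure_VphiHat [IsProbabilityMeasure P] (h : D.IsCategoricalModel P b π)
    (hr : D.Regular P K Qww qwy) (hs : D.ScoreRegular P Vwξ) :
    TendstoInMeasure P D.VphiHat atTop (fun _ => Qww⁻¹ * Vwξ * Qww⁻¹) := by
  have hg : Continuous fun q : Matrix (Fin (p + 1)) (Fin (p + 1)) ℝ ×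
      Matrix (Fin (p + 1)) (Fin (p + 1)) ℝ => q.1 * q.2 * q.1 := by fun_prop
  have := ((tendstoInMeasure_Qn_inv hr).prodMk_const
    (tendstoInMeasure_VwHat h hr hs)).comp_continuousAt hg.continuousAt
  exact this

end RCData

/-! ### Deterministic estimates for the replacement argument. -/

lemma norm_prod_sub_prod_le_sum {ι R : Type*} [NormedCommRing R] [NormOneClass R] (s : Finset ι) {a b : ι → R}
    (ha : ∀ i, ‖a i‖ ≤ 1) (hb : ∀ i, ‖b i‖ ≤ 1) :
    ‖∏ i ∈ s, a i - ∏ i ∈ s, b i‖ ≤ ∑ i ∈ s, ‖a i - b i‖ := by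
  classical
  induction s using Finset.induction_on with
  | empty => simp
  | insert j s hj ih =>
    rw [Finset.prod_insert hj, Finset.prod_insert hj, Finset.sum_insert hj]
    have h1 : ‖∏ i ∈ s, b i‖ ≤ 1 :=
      (Finset.norm_prod_le _ _).trans (Finset.prod_le_one (fun _ _ => norm_nonneg _) fun i _ => hb i)
    -- Telescoping: change one factor at a time, all others having norm at most one.
    calc _ = ‖(a j - b j) * ∏ i ∈ s, b i + a j * (∏ i ∈ s, a i - ∏ i ∈ s, b i)‖ := by
          congr 1; ring
      _ ≤ ‖a j - b j‖ * 1 + 1 * ‖∏ i ∈ s, a i - ∏ i ∈ s, b i‖ := by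
          refine (norm_add_le _ _).trans (add_le_add ?_ ?_)
          · exact (norm_mul_le _ _).trans (mul_le_mul_of_nonneg_left h1 (norm_nonneg _))
          · exact (norm_mul_le _ _).trans (mul_le_mul_of_nonneg_right (ha j) (norm_nonneg _))
      _ ≤ _ := by linarith

lemma Complex.norm_exp_mul_I_le_one (x : ℝ) : ‖Complex.exp (x * Complex.I)‖ ≤ 1 :=
  (Complex.norm_exp_ofReal_mul_I x).le

lemma Complex.norm_exp_neg_sq_div_two_le_one (x : ℝ) :
    ‖Complex.exp ((-(x ^ 2 / 2) : ℝ) : ℂ)‖ ≤ 1 := by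
  rw [Complex.norm_exp_ofReal]
  exact Real.exp_le_one_iff.2 (neg_nonpos.2 (by positivity))

/-- `e^{ix}` and `e^{-x²/2}` agree up to the term `ix` and an error of third order. -/
lemma Complex.norm_exp_mul_I_sub_exp_neg_sq_le (x : ℝ) :
    ‖Complex.exp (x * Complex.I) - Complex.exp ((-(x ^ 2 / 2) : ℝ) : ℂ) - x * Complex.I‖ ≤
      3 * |x| ^ 3 := by
  have hI : ‖(x : ℂ) * Complex.I‖ = |x| := by simp
  -- For small `x`, Taylor expansion: the two polynomials `1 + ix - x²/2` and `1 - x²/2` differ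
  -- exactly by `ix`. For large `x` the trivial bound `2 + |x|` is already below `3|x|³`.
  rcases le_or_gt |x| 1 with hx | hx
  · have h1 := Complex.exp_bound (x := x * Complex.I) (by rwa [hI]) (n := 3) (by norm_num)
    rw [hI] at h1
    have hsq : x ^ 2 = |x| ^ 2 := (sq_abs x).symm
    have h2 : ‖(((-(x ^ 2 / 2) : ℝ) : ℂ))‖ ≤ 1 := by
      rw [Complex.norm_real, Real.norm_eq_abs, abs_neg, abs_of_nonneg (by positivity), hsq]
      nlinarith [abs_nonneg x]
    have h3 := Complex.exp_bound h2 (n := 2) (by norm_num)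
    have h4 : ‖(((-(x ^ 2 / 2) : ℝ) : ℂ))‖ = |x| ^ 2 / 2 := by
      rw [Complex.norm_real, Real.norm_eq_abs, abs_neg, abs_of_nonneg (by positivity), hsq]
    rw [h4] at h3
    have heq : Complex.exp (x * Complex.I) - Complex.exp ((-(x ^ 2 / 2) : ℝ) : ℂ) - x * Complex.I =
        (Complex.exp (x * Complex.I) - ∑ m ∈ Finset.range 3, (x * Complex.I) ^ m / m.factorial) -
        (Complex.exp ((-(x ^ 2 / 2) : ℝ) : ℂ) -
          ∑ m ∈ Finset.range 2, ((-(x ^ 2 / 2) : ℝ) : ℂ) ^ m / m.factorial) := by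
      simp only [Finset.sum_range_succ, Finset.sum_range_zero, mul_pow, Complex.I_sq]
      push_cast
      simp [Nat.factorial]
      ring
    rw [heq]
    refine (norm_sub_le _ _).trans ((add_le_add h1 h3).trans ?_)
    have h5 : (|x| ^ 2 / 2) ^ 2 ≤ |x| ^ 3 := by
      have : |x| ^ 4 ≤ |x| ^ 3 := pow_le_pow_of_le_one (abs_nonneg x) hx (by norm_num)
      nlinarith [pow_nonneg (abs_nonneg x) 3]
    norm_num [Nat.factorial]
    nlinarith [pow_nonneg (abs_nonneg x) 3]
  · have h1 : |x| ≤ |x| ^ 3 := le_self_pow₀ hx.le (by norm_num)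
    calc _ ≤ 1 + 1 + |x| := by
          refine (norm_sub_le _ _).trans (add_le_add ((norm_sub_le _ _).trans (add_le_add ?_ ?_)) hI.le)
          · exact Complex.norm_exp_mul_I_le_one x
          · exact Complex.norm_exp_neg_sq_div_two_le_one x
      _ ≤ 3 * |x| ^ 3 := by linarith

/-! ### Central limit comparison for summands independent given `V`. -/

namespace ProbabilityTheory

variable {Ω : Type*} [MeasurableSpace Ω] {P : Measure Ω} {𝓥 𝓧 : Type*} [MeasurableSpace 𝓥]
  [MeasurableSpace 𝓧]

/-- Pairing two independent sequences of independent variables gives independent pairs. -/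
lemma iIndepFun.prodMk_of_indepFun {ι 𝓨 : Type*} [MeasurableSpace 𝓨] {X : ι → Ω → 𝓧} {Y : ι → Ω → 𝓨}
    (hX : iIndepFun X P) (hY : iIndepFun Y P) (mX : ∀ i, Measurable (X i))
    (mY : ∀ i, Measurable (Y i)) (h : IndepFun (fun ω i => X i ω) (fun ω i => Y i ω) P) :
    iIndepFun (fun i ω => (X i ω, Y i ω)) P := by
  -- Measurable rectangles form a generating π-system, so independence of the pairs need only be
  -- tested on them.
  set R : Set (Set (𝓧 × 𝓨)) :=
    Set.image2 (· ×ˢ ·) {s : Set 𝓧 | MeasurableSet s} {t : Set 𝓨 | MeasurableSet t}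
  refine iIndepSets.iIndep (m := fun i => MeasurableSpace.comap (fun ω => (X i ω, Y i ω))
    inferInstance)
    (fun i => ((mX i).prodMk (mY i)).comap_le)
    (fun i => {s | ∃ t ∈ R, (fun ω => (X i ω, Y i ω)) ⁻¹' t = s})
    (fun i => isPiSystem_prod.comap _) (fun i => ?_) ?_
  · rw [← generateFrom_prod, MeasurableSpace.comap_generateFrom]
    rfl
  · have hbi : ∀ (s : Finset ι) (A : ι → Set 𝓧) (B : ι → Set 𝓨), (∀ i ∈ s, MeasurableSet (A i)) →
        (∀ i ∈ s, MeasurableSet (B i)) →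
        P (⋂ i ∈ s, (fun ω => (X i ω, Y i ω)) ⁻¹' (A i ×ˢ B i)) =
          (∏ i ∈ s, P (X i ⁻¹' A i)) * ∏ i ∈ s, P (Y i ⁻¹' B i) := by
      intro s A B hA hB
      have heq : (⋂ i ∈ s, (fun ω => (X i ω, Y i ω)) ⁻¹' (A i ×ˢ B i)) =
          (fun ω i => X i ω) ⁻¹' (⋂ i ∈ s, (fun x : ι → 𝓧 => x i) ⁻¹' A i) ∩
          (fun ω i => Y i ω) ⁻¹' (⋂ i ∈ s, (fun y : ι → 𝓨 => y i) ⁻¹' B i) := by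
        ext ω
        simp only [Set.mem_iInter, Set.mem_preimage, Set.mem_prod, Set.mem_inter_iff]
        exact ⟨fun hh => ⟨fun i hi => (hh i hi).1, fun i hi => (hh i hi).2⟩,
          fun hh i hi => ⟨hh.1 i hi, hh.2 i hi⟩⟩
      rw [heq, h.measure_inter_preimage_eq_mul _ _
        (Finset.measurableSet_biInter _ fun i hi => measurable_pi_apply i (hA i hi))
        (Finset.measurableSet_biInter _ fun i hi => measurable_pi_apply i (hB i hi))]
      simp only [Set.preimage_iInter]
      congr 1
      · exact hX.measure_inter_preimage_eq_mul s hA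
      · exact hY.measure_inter_preimage_eq_mul s hB
    rw [iIndepSets_iff]
    intro s f hf
    have hf' : ∀ i, ∃ (A : Set 𝓧) (B : Set 𝓨), MeasurableSet A ∧ MeasurableSet B ∧
        (i ∈ s → f i = (fun ω => (X i ω, Y i ω)) ⁻¹' (A ×ˢ B)) := by
      intro i
      by_cases hi : i ∈ s
      · obtain ⟨t, ⟨A, hA, B, hB, rfl⟩, ht⟩ := hf i hi
        exact ⟨A, B, hA, hB, fun _ => ht.symm⟩
      · exact ⟨∅, ∅, .empty, .empty, fun h => absurd h hi⟩
    choose A B hA hB hAB using hf'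
    have h1 : (⋂ i ∈ s, f i) = ⋂ i ∈ s, (fun ω => (X i ω, Y i ω)) ⁻¹' (A i ×ˢ B i) :=
      Set.iInter₂_congr hAB
    rw [h1, hbi s A B (fun i _ => hA i) (fun i _ => hB i), ← Finset.prod_mul_distrib]
    refine Finset.prod_congr rfl fun i hi => ?_
    rw [hAB i hi]
    simpa using (hbi {i} A B (fun i _ => hA i) (fun i _ => hB i)).symm

variable [IsProbabilityMeasure P] {V : Ω → 𝓥} {X : ℕ → Ω → 𝓧}

/-- Given `V`, the expectation of a product of functions of independent variables factorizes. -/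
lemma integral_prod_eq_integral_prod_integral (mV : Measurable V) (mX : ∀ i, Measurable (X i))
    (hX : iIndepFun X P) (hVX : IndepFun V (fun ω i => X i ω) P) (s : Finset ℕ)
    {F : ℕ → 𝓥 × 𝓧 → ℂ} (mF : ∀ i, Measurable (F i)) (hF : ∀ i q, ‖F i q‖ ≤ 1) :
    ∫ ω, ∏ i ∈ s, F i (V ω, X i ω) ∂P = ∫ ω, ∏ i ∈ s, ∫ ω', F i (V ω, X i ω') ∂P ∂P := by
  have mXs : Measurable (fun ω i => X i ω) := measurable_pi_iff.2 mX
  have hmap := (indepFun_iff_map_prod_eq_prod_map_map mV.aemeasurable mXs.aemeasurable).1 hVX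
  have : IsProbabilityMeasure (P.map V) := Measure.isProbabilityMeasure_map mV.aemeasurable
  have : IsProbabilityMeasure (P.map (fun ω i => X i ω)) :=
    Measure.isProbabilityMeasure_map mXs.aemeasurable
  set G : 𝓥 × (ℕ → 𝓧) → ℂ := fun q => ∏ i ∈ s, F i (q.1, q.2 i)
  have mG : Measurable G := Finset.measurable_fun_prod _ fun i _ => (mF i).comp (by fun_prop)
  have hG : ∀ q, ‖G q‖ ≤ 1 := fun q => (Finset.norm_prod_le _ _).trans
    (Finset.prod_le_one (fun _ _ => norm_nonneg _) fun i _ => hF i _)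
  -- By independence the joint law is a product; Fubini freezes `V`, after which the `X i` factorize
  -- as independent variables.
  have h1 : ∫ ω, G (V ω, fun i => X i ω) ∂P =
      ∫ v, ∫ x, G (v, x) ∂(P.map (fun ω i => X i ω)) ∂(P.map V) := by
    rw [← integral_map (f := G) (mV.prodMk mXs).aemeasurable mG.aestronglyMeasurable, hmap,
      integral_prod]
    exact Integrable.of_bound mG.aestronglyMeasurable 1 (ae_of_all _ hG)
  change ∫ ω, G (V ω, fun i => X i ω) ∂P = _
  have mG' : StronglyMeasurable (fun v => ∫ x, G (v, x) ∂(P.map (fun ω i => X i ω))) :=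
    mG.stronglyMeasurable.integral_prod_right
  rw [h1, integral_map mV.aemeasurable mG'.aestronglyMeasurable]
  refine integral_congr_ae (ae_of_all _ fun ω => ?_)
  simp only
  have mGω : Measurable fun x => G (V ω, x) := mG.comp (by fun_prop)
  rw [integral_map mXs.aemeasurable mGω.aestronglyMeasurable]
  have h2 := iIndepFun.integral_fun_prod_comp (X := fun i : s => X i)
    (f := fun (i : s) x => F i (V ω, x))
    (hX.precomp (g := ((↑) : s → ℕ)) Subtype.val_injective) (fun i => (mX i).aemeasurable)
    (fun i => ((mF i).comp measurable_prodMk_left).aestronglyMeasurable)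
  rw [← Finset.prod_coe_sort s (fun i => ∫ ω', F i (V ω, X i ω') ∂P), ← h2]
  refine integral_congr_ae (ae_of_all _ fun η => ?_)
  exact (Finset.prod_coe_sort s (fun i => F i (V ω, X i η))).symm

/-- Lindeberg-type comparison of `E exp(i ∑ g_i)` with `E exp(-∑ g_i² / 2)` for summands that are
centred and independent given `V`. -/
lemma norm_integral_exp_sum_sub_le (mV : Measurable V) (mX : ∀ i, Measurable (X i))
    (hX : iIndepFun X P) (hVX : IndepFun V (fun ω i => X i ω) P) (s : Finset ℕ)
    {g : ℕ → 𝓥 × 𝓧 → ℝ} (mg : ∀ i, Measurable (g i))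
    (hmean : ∀ i v, ∫ ω, g i (v, X i ω) ∂P = 0)
    (h3 : ∀ i, Integrable (fun ω => |g i (V ω, X i ω)| ^ 3) P) :
    ‖∫ ω, Complex.exp ((∑ i ∈ s, g i (V ω, X i ω) : ℝ) * Complex.I) ∂P -
      ∫ ω, Complex.exp ((-((∑ i ∈ s, g i (V ω, X i ω) ^ 2) / 2) : ℝ) : ℂ) ∂P‖ ≤
      3 * ∑ i ∈ s, ∫ ω, |g i (V ω, X i ω)| ^ 3 ∂P := by
  set F : ℕ → 𝓥 × 𝓧 → ℂ := fun i q => Complex.exp (g i q * Complex.I)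
  set G : ℕ → 𝓥 × 𝓧 → ℂ := fun i q => Complex.exp ((-(g i q ^ 2 / 2) : ℝ) : ℂ)
  have mF : ∀ i, Measurable (F i) := fun i => by have := mg i; fun_prop
  have mG : ∀ i, Measurable (G i) := fun i => by have := mg i; fun_prop
  have hF : ∀ i q, ‖F i q‖ ≤ 1 := fun i q => Complex.norm_exp_mul_I_le_one _
  have hG : ∀ i q, ‖G i q‖ ≤ 1 := fun i q => Complex.norm_exp_neg_sq_div_two_le_one _
  have hFs : ∀ ω, Complex.exp ((∑ i ∈ s, g i (V ω, X i ω) : ℝ) * Complex.I) =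
      ∏ i ∈ s, F i (V ω, X i ω) := fun ω => by
    rw [← Complex.exp_sum, Complex.ofReal_sum, Finset.sum_mul]
  have hGs : ∀ ω, Complex.exp ((-((∑ i ∈ s, g i (V ω, X i ω) ^ 2) / 2) : ℝ) : ℂ) =
      ∏ i ∈ s, G i (V ω, X i ω) := fun ω => by
    rw [← Complex.exp_sum, ← Complex.ofReal_sum, Finset.sum_neg_distrib, Finset.sum_div]
  simp_rw [hFs, hGs]
  rw [integral_prod_eq_integral_prod_integral mV mX hX hVX s mF hF,
    integral_prod_eq_integral_prod_integral mV mX hX hVX s mG hG]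
  have hbd : ∀ (H : ℕ → 𝓥 × 𝓧 → ℂ), (∀ i q, ‖H i q‖ ≤ 1) → ∀ i v,
      ‖∫ ω', H i (v, X i ω') ∂P‖ ≤ 1 := fun H hH i v => by
    simpa using norm_integral_le_of_norm_le_const (μ := P) (ae_of_all _ fun ω' => hH i (v, X i ω'))
  have hsm : ∀ (H : ℕ → 𝓥 × 𝓧 → ℂ), (∀ i, Measurable (H i)) → ∀ i,
      Measurable fun ω => ∫ ω', H i (V ω, X i ω') ∂P := fun H mH i => by
    have : StronglyMeasurable fun v => ∫ ω', H i (v, X i ω') ∂P :=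
      StronglyMeasurable.integral_prod_right (f := fun v ω' => H i (v, X i ω'))
        ((mH i).comp (measurable_fst.prodMk ((mX i).comp measurable_snd))).stronglyMeasurable
    exact this.measurable.comp mV
  have hint : ∀ (H : ℕ → 𝓥 × 𝓧 → ℂ), (∀ i, Measurable (H i)) → (∀ i q, ‖H i q‖ ≤ 1) →
      Integrable (fun ω => ∏ i ∈ s, ∫ ω', H i (V ω, X i ω') ∂P) P := fun H mH hH => by
    refine Integrable.of_bound
      (Finset.measurable_fun_prod _ fun i _ => hsm H mH i).aestronglyMeasurable 1
      (ae_of_all _ fun ω => ?_)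
    exact (Finset.norm_prod_le _ _).trans
      (Finset.prod_le_one (fun _ _ => norm_nonneg _) fun i _ => hbd H hH i _)
  -- `X i` is replaced by a copy on a second factor `Ω`: the law of `(V, X i)` is that of `(V q.1, X
  -- i q.2)` under `P × P`. Third moments with `V` frozen therefore exist almost surely and average
  -- to the unconditional ones.
  have hfub : ∀ i, (∀ᵐ ω ∂P, Integrable (fun ω' => |g i (V ω, X i ω')| ^ 3) P) ∧
      Integrable (fun ω => ∫ ω', |g i (V ω, X i ω')| ^ 3 ∂P) P ∧
      ∫ ω, ∫ ω', |g i (V ω, X i ω')| ^ 3 ∂P ∂P = ∫ ω, |g i (V ω, X i ω)| ^ 3 ∂P := by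
    intro i
    have hVi : IndepFun V (X i) P :=
      hVX.comp (φ := id) (ψ := fun x : ℕ → 𝓧 => x i) measurable_id (measurable_pi_apply i)
    have hmap := (indepFun_iff_map_prod_eq_prod_map_map mV.aemeasurable
      (mX i).aemeasurable).1 hVi
    have hprod : Measure.map (fun q : Ω × Ω => (V q.1, X i q.2)) (P.prod P) =
        P.map (fun ω => (V ω, X i ω)) := by
      rw [hmap, Measure.map_prod_map _ _ mV (mX i)]
      rfl
    have mq : Measurable (fun q : Ω × Ω => (V q.1, X i q.2)) := by
      have := mX i
      fun_prop
    have mi : Measurable (fun q : 𝓥 × 𝓧 => |g i q| ^ 3) := by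
      have := mg i
      fun_prop
    have hI : Integrable (fun q : Ω × Ω => |g i (V q.1, X i q.2)| ^ 3) (P.prod P) := by
      have h1 := (integrable_map_measure (g := fun q => |g i q| ^ 3) (μ := P)
        (f := fun ω => (V ω, X i ω)) mi.aestronglyMeasurable (mV.prodMk (mX i)).aemeasurable).2 (h3 i)
      rw [← hprod] at h1
      exact (integrable_map_measure mi.aestronglyMeasurable mq.aemeasurable).1 h1
    refine ⟨hI.prod_right_ae, hI.integral_prod_left, ?_⟩
    rw [← integral_prod _ hI, ← integral_map (f := fun q => |g i q| ^ 3)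
      (φ := fun ω => (V ω, X i ω)) (mV.prodMk (mX i)).aemeasurable mi.aestronglyMeasurable, ← hprod,
      integral_map mq.aemeasurable mi.aestronglyMeasurable]
  have hterm : ∀ i, ∀ᵐ ω ∂P, ‖∫ ω', F i (V ω, X i ω') ∂P - ∫ ω', G i (V ω, X i ω') ∂P‖ ≤
      3 * ∫ ω', |g i (V ω, X i ω')| ^ 3 ∂P := by
    intro i
    filter_upwards [(hfub i).1] with ω hω
    have ms : Measurable fun ω' => (V ω, X i ω') := measurable_const.prodMk (mX i)
    have hFi : Integrable (fun ω' => F i (V ω, X i ω')) P :=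
      Integrable.of_bound ((mF i).comp ms).aestronglyMeasurable 1 (ae_of_all _ fun _ => hF _ _)
    have hGi : Integrable (fun ω' => G i (V ω, X i ω')) P :=
      Integrable.of_bound ((mG i).comp ms).aestronglyMeasurable 1 (ae_of_all _ fun _ => hG _ _)
    have hgi : Integrable (fun ω' => g i (V ω, X i ω')) P := by
      refine ((integrable_const (1 : ℝ)).add hω).mono' ((mg i).comp ms).aestronglyMeasurable
        (ae_of_all _ fun ω' => ?_)
      simp only [Real.norm_eq_abs, Pi.add_apply]
      rcases le_total |g i (V ω, X i ω')| 1 with hle | hle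
      · linarith [pow_nonneg (abs_nonneg (g i (V ω, X i ω'))) 3]
      · linarith [le_self_pow₀ hle (n := 3) (by norm_num)]
    have hgi' : Integrable (fun ω' => (g i (V ω, X i ω') : ℂ) * Complex.I) P :=
      hgi.ofReal.mul_const _
    have h0 : ∫ ω', (g i (V ω, X i ω') : ℂ) * Complex.I ∂P = 0 := by
      rw [integral_mul_const, integral_complex_ofReal, hmean i]
      simp
    have hFG : Integrable (fun ω' => F i (V ω, X i ω') - G i (V ω, X i ω')) P := hFi.sub hGi
    -- The linear term `i g` integrates to zero for frozen `V`, so it can be inserted for free,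
    -- leaving the cubic remainder.
    rw [← sub_zero (_ - _), ← h0, ← integral_sub hFi hGi, ← integral_sub hFG hgi',
      ← integral_const_mul]
    exact norm_integral_le_of_norm_le (hω.const_mul 3)
      (ae_of_all _ fun ω' => Complex.norm_exp_mul_I_sub_exp_neg_sq_le _)
  rw [← integral_sub (hint F mF hF) (hint G mG hG), Finset.mul_sum]
  have hall : ∀ᵐ ω ∂P, ∀ i, ‖∫ ω', F i (V ω, X i ω') ∂P - ∫ ω', G i (V ω, X i ω') ∂P‖ ≤
      3 * ∫ ω', |g i (V ω, X i ω')| ^ 3 ∂P := ae_all_iff.2 hterm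
  have hle : ‖∫ ω, (∏ i ∈ s, ∫ ω', F i (V ω, X i ω') ∂P) -
      ∏ i ∈ s, ∫ ω', G i (V ω, X i ω') ∂P ∂P‖ ≤
      ∫ ω, ∑ i ∈ s, 3 * ∫ ω', |g i (V ω, X i ω')| ^ 3 ∂P ∂P := by
    refine norm_integral_le_of_norm_le
      (integrable_finsetSum _ fun i _ => (hfub i).2.1.const_mul 3) ?_
    filter_upwards [hall] with ω hω
    exact (norm_prod_sub_prod_le_sum s (fun i => hbd F hF i _) (fun i => hbd G hG i _)).trans
      (Finset.sum_le_sum fun i _ => hω i)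
  refine hle.trans_eq ?_
  rw [integral_finsetSum _ fun i _ => (hfub i).2.1.const_mul 3]
  refine Finset.sum_congr rfl fun i _ => ?_
  rw [integral_const_mul, (hfub i).2.2]

end ProbabilityTheory

/-! ### Characteristic function of the scaled score. -/

namespace RCData

variable {Ω : Type*} [MeasurableSpace Ω] {P : Measure Ω} {p K : ℕ}
  {D : RCData Ω p} {b π : Fin K → ℝ} {Qww Vwξ : Matrix (Fin (p + 1)) (Fin (p + 1)) ℝ}
  {qwy : EuclideanSpace ℝ (Fin (p + 1))}

lemma measurable_dotProduct_w (h : D.IsCategoricalModel P b π) (s : EuclideanSpace ℝ (Fin (p + 1)))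
    (i : ℕ) : Measurable fun ω => s ⬝ᵥ D.w i ω := by
  simp only [dotProduct]
  exact Finset.measurable_fun_sum _ fun a _ => (h.measurable_w_apply i a).const_mul _

/-- From `|ξ| ≤ |u| + B‖w‖` and `(a + b)³ ≤ 4(a³ + b³)`, the cube is controlled by `|u|³‖w‖³`, whose
mean factorizes by independence, and by `‖w‖⁶`. -/
lemma exists_third_moment_bound [IsProbabilityMeasure P] (h : D.IsCategoricalModel P b π) (hr : D.Regular P K Qww qwy)
    (s : EuclideanSpace ℝ (Fin (p + 1))) :
    ∃ C : ℝ, ∀ i, Integrable (fun ω => |(s ⬝ᵥ D.w i ω) * D.xi P i ω| ^ 3) P ∧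
      ∫ ω, |(s ⬝ᵥ D.w i ω) * D.xi P i ω| ^ 3 ∂P ≤ C := by
  obtain ⟨B, hB0, hB⟩ := h.exists_bound
  obtain ⟨Cu, hCu⟩ := hr.u_moments
  obtain ⟨Cw, hCw⟩ := hr.w_moments
  have hK := h.two_le
  have hu3 : ∀ i, _ := fun i => hCu i 3 (Finset.mem_Icc.2 ⟨by norm_num, by omega⟩)
  have hw3 : ∀ i, _ := fun i => hCw i 3 (Finset.mem_Icc.2 ⟨by norm_num, by omega⟩)
  have hw6 : ∀ i, _ := fun i => hCw i 6 (Finset.mem_Icc.2 ⟨by norm_num, by omega⟩)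
  refine ⟨4 * ‖s‖ ^ 3 * (Cu * Cw + B ^ 3 * Cw), fun i => ?_⟩
  have hind : IndepFun (fun ω => |D.u i ω| ^ 3) (fun ω => ‖D.w i ω‖ ^ 3) P :=
    (indepFun_u_w hr i).comp (φ := fun t : ℝ => |t| ^ 3)
      (ψ := fun v : EuclideanSpace ℝ (Fin (p + 1)) => ‖v‖ ^ 3) (by fun_prop) (by fun_prop)
  have hI1 : Integrable (fun ω => |D.u i ω| ^ 3 * ‖D.w i ω‖ ^ 3) P :=
    hind.integrable_mul (hu3 i).1 (hw3 i).1
  have hI : Integrable (fun ω => 4 * ‖s‖ ^ 3 * (|D.u i ω| ^ 3 * ‖D.w i ω‖ ^ 3 +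
      B ^ 3 * ‖D.w i ω‖ ^ 6)) P := (hI1.add ((hw6 i).1.const_mul _)).const_mul _
  have hle : ∀ᵐ ω ∂P, |(s ⬝ᵥ D.w i ω) * D.xi P i ω| ^ 3 ≤
      4 * ‖s‖ ^ 3 * (|D.u i ω| ^ 3 * ‖D.w i ω‖ ^ 3 + B ^ 3 * ‖D.w i ω‖ ^ 6) := by
    filter_upwards [hB i] with ω hω
    have h1 : |D.xi P i ω| ≤ |D.u i ω| + ‖D.w i ω‖ * B := by
      rw [xi]
      refine (abs_add_le _ _).trans (add_le_add_right ?_ _)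
      rw [abs_mul]
      exact mul_le_mul (D.abs_x_le i ω) hω (abs_nonneg _) (norm_nonneg _)
    have h2 := add_pow_le (abs_nonneg (D.u i ω)) (mul_nonneg (norm_nonneg (D.w i ω)) hB0) 3
    calc |(s ⬝ᵥ D.w i ω) * D.xi P i ω| ^ 3
        ≤ ((‖s‖ * ‖D.w i ω‖) * (|D.u i ω| + ‖D.w i ω‖ * B)) ^ 3 := by
          rw [abs_mul]
          gcongr
          exact abs_dotProduct_le_norm_mul_norm _ _
      _ = ‖s‖ ^ 3 * ‖D.w i ω‖ ^ 3 * (|D.u i ω| + ‖D.w i ω‖ * B) ^ 3 := by ring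
      _ ≤ ‖s‖ ^ 3 * ‖D.w i ω‖ ^ 3 *
          (2 ^ (3 - 1) * (|D.u i ω| ^ 3 + (‖D.w i ω‖ * B) ^ 3)) := by gcongr
      _ = _ := by norm_num; ring
  have hm : AEStronglyMeasurable (fun ω => |(s ⬝ᵥ D.w i ω) * D.xi P i ω| ^ 3) P := by
    have := measurable_dotProduct_w h s i
    have := h.measurable_xi i
    fun_prop
  have hInt : Integrable (fun ω => |(s ⬝ᵥ D.w i ω) * D.xi P i ω| ^ 3) P := by
    refine hI.mono' hm ?_
    filter_upwards [hle] with ω hω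
    rwa [Real.norm_of_nonneg (by positivity)]
  refine ⟨hInt, (integral_mono_ae hInt hI hle).trans ?_⟩
  rw [integral_const_mul, integral_add hI1 ((hw6 i).1.const_mul _), integral_const_mul,
    hind.integral_fun_mul_eq_mul_integral (hu3 i).1.aestronglyMeasurable
      (hw3 i).1.aestronglyMeasurable]
  have h0 : 0 ≤ ∫ ω, ‖D.w i ω‖ ^ 3 ∂P := integral_nonneg fun _ => by positivity
  have h0' : 0 ≤ ∫ ω, |D.u i ω| ^ 3 ∂P := integral_nonneg fun _ => by positivity
  have h5 := mul_le_mul (hu3 i).2 (hw3 i).2 h0 (h0'.trans (hu3 i).2)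
  have h6 := (hw6 i).2
  gcongr

lemma dotProduct_Vn_mulVec (D : RCData Ω p) (n : ℕ) (ω : Ω) (s : Fin (p + 1) → ℝ) :
    s ⬝ᵥ D.Vn P n ω *ᵥ s =
      (n : ℝ)⁻¹ * ∑ i ∈ Finset.range n, ((s ⬝ᵥ D.w i ω) * D.xi P i ω) ^ 2 := by
  rw [Vn, Matrix.smul_mulVec, Matrix.sum_mulVec, dotProduct_smul, dotProduct_sum, smul_eq_mul]
  congr 1
  refine Finset.sum_congr rfl fun i _ => ?_
  rw [Matrix.smul_mulVec, Matrix.vecMulVec_mulVec, dotProduct_smul]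
  simp only [op_smul_eq_smul, dotProduct_smul, smul_eq_mul, dotProduct_comm (D.w i ω).ofLp s]
  ring

lemma dotProduct_score (D : RCData Ω p) (n : ℕ) (ω : Ω) (s : Fin (p + 1) → ℝ) :
    s ⬝ᵥ D.score P n ω = (n : ℝ)⁻¹ * ∑ i ∈ Finset.range n, (s ⬝ᵥ D.w i ω) * D.xi P i ω := by
  rw [score, WithLp.ofLp_smul, WithLp.ofLp_sum, dotProduct_smul, dotProduct_sum, smul_eq_mul]
  congr 1
  refine Finset.sum_congr rfl fun i _ => ?_
  rw [WithLp.ofLp_smul, dotProduct_smul, smul_eq_mul, mul_comm]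

lemma norm_integral_exp_score_sub_le [IsProbabilityMeasure P] (h : D.IsCategoricalModel P b π)
    (hr : D.Regular P K Qww qwy) (hi : D.IndepSequences P)
    (s : EuclideanSpace ℝ (Fin (p + 1))) {C : ℝ}
    (hC : ∀ i, Integrable (fun ω => |(s ⬝ᵥ D.w i ω) * D.xi P i ω| ^ 3) P ∧
      ∫ ω, |(s ⬝ᵥ D.w i ω) * D.xi P i ω| ^ 3 ∂P ≤ C) (n : ℕ) :
    ‖∫ ω, Complex.exp ((√n * (s ⬝ᵥ D.score P n ω) : ℝ) * Complex.I) ∂P -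
      ∫ ω, Complex.exp ((-((s ⬝ᵥ D.Vn P n ω *ᵥ s) / 2) : ℝ) : ℂ) ∂P‖ ≤ 3 * C * rootRate n := by
  -- The frozen variable is the entire regressor sequence, and the independent ones are the pairs
  -- `(β_i, u_i)`. For fixed regressors `g` is affine in the pair, hence centred.
  set g : ℕ → (ℕ → EuclideanSpace ℝ (Fin (p + 1))) × (ℝ × ℝ) → ℝ := fun i q =>
    (√n)⁻¹ * ((s ⬝ᵥ q.1 i) * (q.2.2 + q.1 i 0 * (q.2.1 - ∫ ω', D.β i ω' ∂P)))
  have hgeq : ∀ i ω, g i (fun j => D.w j ω, (D.β i ω, D.u i ω)) =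
      (√n)⁻¹ * ((s ⬝ᵥ D.w i ω) * D.xi P i ω) := fun i ω => rfl
  have mg : ∀ i, Measurable (g i) := fun i => by
    simp only [g, dotProduct]
    fun_prop
  have hmean : ∀ i v, ∫ ω, g i (v, (D.β i ω, D.u i ω)) ∂P = 0 := by
    intro i v
    obtain ⟨B, -, hB⟩ := h.exists_bound
    have hmβ := h.measurable_β i
    have hβ : Integrable (fun ω => D.β i ω - ∫ ω', D.β i ω' ∂P) P :=
      (integrable_const B).mono' (by fun_prop) (hB i)
    have hβi : Integrable (D.β i) P := by
      refine (hβ.add (integrable_const (∫ ω', D.β i ω' ∂P))).congr (ae_of_all _ fun ω => ?_)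
      simp
    simp only [g]
    rw [integral_const_mul, integral_const_mul, integral_add (integrable_u h hr i)
      (hβ.const_mul _), h.u_mean, integral_const_mul, integral_sub hβi (integrable_const _)]
    simp
  have hcube : ∀ i ω, |g i (fun j => D.w j ω, (D.β i ω, D.u i ω))| ^ 3 =
      (√n)⁻¹ ^ 3 * |(s ⬝ᵥ D.w i ω) * D.xi P i ω| ^ 3 := fun i ω => by
    rw [hgeq, abs_mul, abs_of_nonneg (by positivity : 0 ≤ (√(n : ℝ))⁻¹), mul_pow]
  have hind : iIndepFun (fun i ω => (D.β i ω, D.u i ω)) P :=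
    h.β_iIndep.prodMk_of_indepFun h.u_iIndep h.measurable_β h.measurable_u hi.β_indep_u
  have key := norm_integral_exp_sum_sub_le (P := P) (V := fun ω j => D.w j ω)
    (X := fun i ω => (D.β i ω, D.u i ω)) (measurable_pi_iff.2 h.measurable_w)
    (fun i => (h.measurable_β i).prodMk (h.measurable_u i)) hind hi.w_indep (Finset.range n) mg
    hmean (fun i => by
      simp only [hcube]
      exact (hC i).1.const_mul _)
  simp only [hcube] at key
  simp only [hgeq, integral_const_mul, mul_pow, ← Finset.mul_sum] at key
  have hn : (√(n : ℝ))⁻¹ = √n * (n : ℝ)⁻¹ := by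
    rw [← Real.sqrt_div_self, div_eq_mul_inv]
  have hsq : (√(n : ℝ))⁻¹ ^ 2 = (n : ℝ)⁻¹ := by rw [inv_pow, Real.sq_sqrt (by positivity)]
  simp only [dotProduct_score, dotProduct_Vn_mulVec, mul_pow]
  rw [hsq] at key
  simp only [← mul_assoc (√(n : ℝ)), ← hn]
  refine key.trans ?_
  have hsum : ∑ i ∈ Finset.range n, ∫ ω, |(s ⬝ᵥ D.w i ω) * D.xi P i ω| ^ 3 ∂P ≤ n * C := by
    simpa using Finset.sum_le_card_nsmul (Finset.range n) _ C fun i _ => (hC i).2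
  -- `n` cubes, each scaled by `n^{-3/2}`, leave `n^{-1/2}`; the case `n = 0` holds because `0⁻¹ =
  -- 0`.
  calc _ ≤ 3 * ((√(n : ℝ))⁻¹ ^ 3 * (n * C)) := by gcongr
    _ = _ := by
      rw [rootRate]
      rcases Nat.eq_zero_or_pos n with rfl | hpos
      · simp
      · have : (0 : ℝ) < n := by exact_mod_cast hpos
        rw [pow_succ, hsq]
        field_simp

lemma measurable_Qn_apply (h : D.IsCategoricalModel P b π) (n : ℕ) (a c : Fin (p + 1)) :
    Measurable fun ω => D.Qn n ω a c := by
  simp only [Qn, Matrix.smul_apply, Matrix.sum_apply, Matrix.vecMulVec_apply, smul_eq_mul]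
  exact (Finset.measurable_fun_sum _ fun i _ =>
    (h.measurable_w_apply i a).mul (h.measurable_w_apply i c)).const_mul _

lemma measurable_score (h : D.IsCategoricalModel P b π) (n : ℕ) : Measurable (D.score P n) :=
  Measurable.const_smul (g := fun ω => ∑ i ∈ Finset.range n, D.xi P i ω • D.w i ω)
    (Finset.measurable_fun_sum _ fun i _ => (h.measurable_xi i).smul (h.measurable_w i)) (n : ℝ)⁻¹

lemma measurable_y [IsProbabilityMeasure P] (h : D.IsCategoricalModel P b π) (i : ℕ) :
    Measurable (D.y i) := by
  rw [show D.y i = fun ω => (D.phi P ⬝ᵥ D.w i ω) + D.xi P i ω from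
    funext fun ω => by rw [y_eq h, dotProduct_comm]]
  exact (measurable_dotProduct_w h _ i).add (h.measurable_xi i)

lemma measurable_qn [IsProbabilityMeasure P] (h : D.IsCategoricalModel P b π) (n : ℕ) :
    Measurable (D.qn n) :=
  Measurable.const_smul (g := fun ω => ∑ i ∈ Finset.range n, D.y i ω • D.w i ω)
    (Finset.measurable_fun_sum _ fun i _ => (measurable_y h i).smul (h.measurable_w i)) (n : ℝ)⁻¹

lemma measurable_phiHat [IsProbabilityMeasure P] (h : D.IsCategoricalModel P b π) (n : ℕ) : Measurable (D.phiHat n) := by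
  refine (WithLp.measurable_toLp 2 _).comp (measurable_pi_iff.2 fun a => ?_)
  simp only [Matrix.mulVec, dotProduct]
  exact Finset.measurable_fun_sum _ fun c _ =>
    (Measurable.matrix_inv_apply (measurable_Qn_apply h n) a c).mul
      ((measurable_pi_apply c).comp ((WithLp.measurable_ofLp 2 _).comp (measurable_qn h n)))

end RCData

namespace RCData

variable {Ω : Type*} [MeasurableSpace Ω] {P : Measure Ω} {p K : ℕ}
  {D : RCData Ω p} {b π : Fin K → ℝ} {Qww Vwξ : Matrix (Fin (p + 1)) (Fin (p + 1)) ℝ}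
  {qwy : EuclideanSpace ℝ (Fin (p + 1))}

lemma tendsto_integral_exp_score [IsProbabilityMeasure P] (h : D.IsCategoricalModel P b π)
    (hr : D.Regular P K Qww qwy) (hs : D.ScoreRegular P Vwξ) (hi : D.IndepSequences P)
    (s : EuclideanSpace ℝ (Fin (p + 1))) :
    Tendsto (fun n : ℕ => ∫ ω, Complex.exp ((√n * (s ⬝ᵥ D.score P n ω) : ℝ) * Complex.I) ∂P)
      atTop (𝓝 (Complex.exp ((-((s ⬝ᵥ Vwξ *ᵥ s) / 2) : ℝ) : ℂ))) := by
  obtain ⟨C, hC⟩ := exists_third_moment_bound h hr s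
  have h1 : Tendsto (fun n : ℕ =>
      ∫ ω, Complex.exp ((√n * (s ⬝ᵥ D.score P n ω) : ℝ) * Complex.I) ∂P -
      ∫ ω, Complex.exp ((-((s ⬝ᵥ D.Vn P n ω *ᵥ s) / 2) : ℝ) : ℂ) ∂P) atTop (𝓝 0) :=
    squeeze_zero_norm (norm_integral_exp_score_sub_le h hr hi s hC)
      (by simpa using tendsto_rootRate.const_mul (3 * C))
  have hg : Continuous fun A : Matrix (Fin (p + 1)) (Fin (p + 1)) ℝ => s.ofLp ⬝ᵥ A *ᵥ s.ofLp := by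
    fun_prop
  have hV : TendstoInMeasure P (fun n ω => s ⬝ᵥ D.Vn P n ω *ᵥ s) atTop
      (fun _ => s ⬝ᵥ Vwξ *ᵥ s) := by
    have := (tendstoInMeasure_Vn hs).comp_continuousAt hg.continuousAt
    exact this
  have hm : ∀ n, AEMeasurable (fun ω => s ⬝ᵥ D.Vn P n ω *ᵥ s) P := by
    intro n
    have hsum : Measurable fun ω => ∑ i ∈ Finset.range n, ((s ⬝ᵥ D.w i ω) * D.xi P i ω) ^ 2 :=
      Finset.measurable_fun_sum _ fun i _ =>
        ((measurable_dotProduct_w h s i).mul (h.measurable_xi i)).pow_const 2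
    rw [show (fun ω => s ⬝ᵥ D.Vn P n ω *ᵥ s) = fun ω => (n : ℝ)⁻¹ *
      ∑ i ∈ Finset.range n, ((s ⬝ᵥ D.w i ω) * D.xi P i ω) ^ 2 from
      funext fun ω => dotProduct_Vn_mulVec D n ω s]
    exact (hsum.const_mul _).aemeasurable
  -- Truncation at zero makes `exp(-x/2)` bounded; it changes nothing here since the quadratic forms
  -- are nonnegative.
  let f : BoundedContinuousFunction ℝ ℝ :=
    BoundedContinuousFunction.ofNormedAddCommGroup (fun x => Real.exp (-(max x 0 / 2)))
      (by fun_prop) 1 fun x => by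
        rw [Real.norm_of_nonneg (Real.exp_pos _).le]
        exact Real.exp_le_one_iff.2 (neg_nonpos.2 (by positivity))
  have h2 := hV.tendsto_integral_comp hm f
  have hpos : 0 ≤ s ⬝ᵥ Vwξ *ᵥ s := by
    simpa using hs.Vwξ_posDef.posSemidef.dotProduct_mulVec_nonneg s.ofLp
  have hposn : ∀ n ω, 0 ≤ s ⬝ᵥ D.Vn P n ω *ᵥ s := fun n ω => by
    rw [dotProduct_Vn_mulVec]
    positivity
  have hf : ∀ x, f x = Real.exp (-(max x 0 / 2)) := fun x => rfl
  simp only [hf, max_eq_left hpos, max_eq_left (hposn _ _)] at h2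
  have h3 : Tendsto (fun n => ∫ ω, Complex.exp ((-((s ⬝ᵥ D.Vn P n ω *ᵥ s) / 2) : ℝ) : ℂ) ∂P) atTop
      (𝓝 (Complex.exp ((-((s ⬝ᵥ Vwξ *ᵥ s) / 2) : ℝ) : ℂ))) := by
    simp only [← Complex.ofReal_exp, integral_complex_ofReal]
    exact (Complex.continuous_ofReal.tendsto _).comp h2
  simpa using h1.add h3

end RCData

lemma IsBigOInProb.sqrt_mul {Ω : Type*} [MeasurableSpace Ω] {P : Measure Ω} {X : ℕ → Ω → ℝ}
    (h : IsBigOInProb P X rootRate) :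
    IsBigOInProb P (fun n ω => √n * X n ω) (fun _ => 1) := by
  intro ε hε
  obtain ⟨M, hM⟩ := h ε hε
  refine ⟨M, ?_⟩
  filter_upwards [hM, eventually_gt_atTop 0] with n hn hpos
  refine (measure_mono fun ω hω => ?_).trans hn
  have hs : (0 : ℝ) < √n := Real.sqrt_pos.2 (by exact_mod_cast hpos)
  simp only [Set.mem_ofPred_eq, mul_one, abs_mul, abs_of_pos hs] at hω ⊢
  rw [rootRate, ← div_eq_mul_inv, div_lt_iff₀ hs]
  linarith

/-! ### Linearization and the limit law. -/

namespace RCData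

variable {Ω : Type*} [MeasurableSpace Ω] {P : Measure Ω} {p K : ℕ}
  {D : RCData Ω p} {b π : Fin K → ℝ} {Qww Vwξ : Matrix (Fin (p + 1)) (Fin (p + 1)) ℝ}
  {qwy : EuclideanSpace ℝ (Fin (p + 1))}

lemma measurable_scaledScore (h : D.IsCategoricalModel P b π)
    (A : Matrix (Fin (p + 1)) (Fin (p + 1)) ℝ) (n : ℕ) :
    Measurable fun ω => √n • WithLp.toLp 2 (A *ᵥ D.score P n ω) := by
  have h1 : Measurable fun ω => WithLp.toLp 2 (A *ᵥ D.score P n ω) := by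
    refine (WithLp.measurable_toLp 2 _).comp (measurable_pi_iff.2 fun a => ?_)
    simp only [Matrix.mulVec, dotProduct]
    exact Finset.measurable_fun_sum _ fun c _ => Measurable.const_mul
      ((measurable_pi_apply c).comp ((WithLp.measurable_ofLp 2 _).comp (measurable_score h n))) _
  exact h1.const_smul (√n)

/-- Asymptotic normality of the linearization `√n Q_ww⁻¹ (n⁻¹ ∑ w_i ξ_i)`. -/
lemma tendstoInDistribution_scaledScore [IsProbabilityMeasure P] (h : D.IsCategoricalModel P b π)
    (hr : D.Regular P K Qww qwy) (hs : D.ScoreRegular P Vwξ) (hi : D.IndepSequences P) :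
    TendstoInDistribution (fun (n : ℕ) ω => √n • WithLp.toLp 2 (Qww⁻¹ *ᵥ D.score P n ω)) atTop id
      (fun _ => P) (multivariateGaussian 0 (Qww⁻¹ * Vwξ * Qww⁻¹)) := by
  have hm := fun n => measurable_scaledScore (P := P) h Qww⁻¹ n
  have hsymm : (Qww⁻¹)ᴴ = Qww⁻¹ := hr.Qww_posDef.inv.isHermitian
  have hsymm' : (Qww⁻¹)ᵀ = Qww⁻¹ := by
    rwa [Matrix.conjTranspose_eq_transpose_of_trivial] at hsymm
  have hpsd : (Qww⁻¹ * Vwξ * Qww⁻¹).PosSemidef := by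
    have := hs.Vwξ_posDef.posSemidef.mul_mul_conjTranspose_same Qww⁻¹
    rwa [hsymm] at this
  refine ⟨fun n => (hm n).aemeasurable, aemeasurable_id, ?_⟩
  refine ProbabilityMeasure.tendsto_of_tendsto_charFun fun t => ?_
  simp only [ProbabilityMeasure.coe_mk, Measure.map_id]
  rw [charFun_multivariateGaussian hpsd]
  -- Testing the linearization against `t` amounts to testing the score against `Qww⁻¹ t`, as
  -- `Qww⁻¹` is symmetric.
  have hlim := tendsto_integral_exp_score h hr hs hi (WithLp.toLp 2 (Qww⁻¹ *ᵥ t))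
  have hvec : t.ofLp ᵥ* Qww⁻¹ = Qww⁻¹ *ᵥ t.ofLp := by
    rw [← Matrix.vecMul_transpose, hsymm']
  have hquad : (Qww⁻¹ *ᵥ t.ofLp) ⬝ᵥ Vwξ *ᵥ (Qww⁻¹ *ᵥ t.ofLp) =
      t.ofLp ⬝ᵥ (Qww⁻¹ * Vwξ * Qww⁻¹) *ᵥ t.ofLp := by
    rw [← Matrix.mulVec_mulVec, ← Matrix.mulVec_mulVec, Matrix.dotProduct_mulVec t.ofLp, hvec]
  simp only [hquad] at hlim
  convert hlim using 1
  · ext n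
    rw [charFun_apply, integral_map (hm n).aemeasurable (by fun_prop)]
    refine integral_congr_ae (ae_of_all _ fun ω => ?_)
    simp only
    congr 3
    rw [real_inner_smul_left, EuclideanSpace.inner_eq_star_dotProduct, star_trivial,
      Matrix.dotProduct_mulVec, hvec]
  · congr 2
    simp

/-- Where `Q_n` is invertible the difference is `(Q_n⁻¹ - Qww⁻¹) √n s_n`, a matrix tending to zero
in probability applied to an `O_p(1)` vector. -/
lemma tendstoInMeasure_linearization_error [IsProbabilityMeasure P] (h : D.IsCategoricalModel P b π)
    (hr : D.Regular P K Qww qwy) :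
    TendstoInMeasure P (fun (n : ℕ) ω => √n • (D.phiHat n ω - D.phi P) -
      √n • WithLp.toLp 2 (Qww⁻¹ *ᵥ D.score P n ω)) atTop (fun _ => 0) := by
  have hg : Continuous fun A : Matrix (Fin (p + 1)) (Fin (p + 1)) ℝ => ‖A - Qww⁻¹‖ := by fun_prop
  have h1 := (tendstoInMeasure_Qn_inv hr).comp_continuousAt hg.continuousAt
  simp only [sub_self, norm_zero] at h1
  refine tendstoInMeasure_zero_of_tendsto_measure
    (h1.mul_isBigOInProb (score_rate h hr).sqrt_mul) ?_
  refine tendsto_of_tendsto_of_tendsto_of_le_of_le tendsto_const_nhds (tendsto_measure_bad_Qn hr)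
    (fun _ => zero_le) fun n => measure_mono fun ω hω => ?_
  simp only [Set.mem_ofPred_eq] at hω ⊢
  contrapose! hω
  rw [phiHat_sub_phi h hω.1, ← smul_sub, ← WithLp.toLp_sub, ← Matrix.sub_mulVec, norm_smul,
    Real.norm_of_nonneg (Real.sqrt_nonneg _), abs_of_nonneg (by positivity)]
  calc _ ≤ √n * (‖(D.Qn n ω)⁻¹ - Qww⁻¹‖ * ‖D.score P n ω‖) :=
        mul_le_mul_of_nonneg_left (Matrix.l2_opNorm_mulVec _ _) (Real.sqrt_nonneg _)
    _ = _ := by ring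

/-- Slutsky: the estimator inherits the limit law of its linearization. -/
lemma tendstoInDistribution_phiHat [IsProbabilityMeasure P] (h : D.IsCategoricalModel P b π)
    (hr : D.Regular P K Qww qwy) (hs : D.ScoreRegular P Vwξ) (hi : D.IndepSequences P) :
    TendstoInDistribution (fun (n : ℕ) ω => √n • (D.phiHat n ω - D.phi P)) atTop id
      (fun _ => P) (multivariateGaussian 0 (Qww⁻¹ * Vwξ * Qww⁻¹)) :=
  tendstoInDistribution_of_tendstoInMeasure_sub _ _
    (tendstoInDistribution_scaledScore h hr hs hi) (tendstoInMeasure_linearization_error h hr)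
    fun n => (((measurable_phiHat h n).sub_const _).const_smul (√(n : ℝ))).aemeasurable

end RCData

theorem theorem3 {Ω : Type*} [MeasurableSpace Ω] (P : Measure Ω) [IsProbabilityMeasure P]
    {p K : ℕ} (D : RCData Ω p) (b π : Fin K → ℝ)
    (Qww Vwξ : Matrix (Fin (p + 1)) (Fin (p + 1)) ℝ) (qwy : EuclideanSpace ℝ (Fin (p + 1)))
    (hmodel : D.IsCategoricalModel P b π) (hreg : D.Regular P K Qww qwy) :
    (TendstoInMeasure P D.phiHat atTop (fun _ => D.phi P) ∧
      IsBigOInProb P (fun n ω => ‖D.phiHat n ω - D.phi P‖) rootRate) ∧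
    (D.ScoreRegular P Vwξ →
      (D.IndepSequences P →
        TendstoInDistribution (fun (n : ℕ) ω => Real.sqrt n • (D.phiHat n ω - D.phi P)) atTop id
          (fun _ => P) (multivariateGaussian 0 (Qww⁻¹ * Vwξ * Qww⁻¹))) ∧
      TendstoInMeasure P D.VphiHat atTop (fun _ => Qww⁻¹ * Vwξ * Qww⁻¹)) := by

  exact ⟨⟨RCData.tendstoInMeasure_phiHat hmodel hreg, RCData.phiHat_rate hmodel hreg⟩,
    fun hs => ⟨fun hi => RCData.tendstoInDistribution_phiHat hmodel hreg hs hi,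
      RCData.tendstoInMeasure_VphiHat hmodel hreg hs⟩⟩
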